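/- **Setting.** Let $G=(V,E)$ be a finite connected graph with $|V|\ge 2$ in which every node has a self-loop, $A$ its adjacency matrix (with ones on the diagonal), $\deg(v)=\sum_u A(v,u)$. Each node $v$ has a loss $f_v:\mathbb R^d\to\mathbb R$ and a constant $L_v>0$; put $\bar L=\frac1{|V|}\sum_v L_v$, $L_{\min}=\min_v L_v$, and let $x^*$ minimize $\frac1{|V|}\sum_v f_v$. Let $P_{IS}$ be the Metropolis–Hastings matrix with $P_{IS}(i,j)=\frac1{\deg(i)}\min\{1,\frac{\deg(i)L_j}{\deg(j)L_i}\}$ for edges $i\ne j$, $P_{IS}(i,j)=0$ for non-edges $i\neq j$, and $P_{IS}(i,i)=1-\sum_{k\ne i}P_{IS}(i,k)$. For $0<p_d\le1$ and an integer $r\ge1$ let $$P_{\text{Lévy}}=\sum_{i=1}^r\frac{p_d(1-p_d)^{i-1}}{1-(1-p_d)^r}\,\mathrm{diag}\{A^i\mathbf 1\}^{-1}A^i ;$$ the result is also claimed with $(\mathrm{diag}\{A\mathbf 1\}^{-1}A)^i$ in place of $\mathrm{diag}\{A^i\mathbf 1\}^{-1}A^i$ (a jump made of $i$ uniform neighbor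 moves). For $p_J\in[0,1]$ let $P=(1-p_J)P_{IS}+p_JP_{\text{Lévy}}$ with stationary distribution $\nu$, and let $\tau_{mix}=\min\{t:\max_v\|P^t(v,\cdot)-\nu\|_{TV}\le\frac14\}$. Write $\|M\|_1=\max_i\sum_j|M(i,j)|$. The MHLJ algorithm with step size $\gamma$ runs $x^{t+1}=x^t-\gamma\frac{\bar L}{L_{v_t}}\nabla f_{v_t}(x^t)$ from $x^0$, where $(v_t)$ is a Markov chain with transition matrix $P$ and arbitrary initial distribution. **Theorem (Convergence of Algorithm MHLJ).** Suppose that each $f_v$ is $L_v$-smooth (differentiable with $L_v$-Lipschitz gradient) and $\mu$-strongly convex with $\mu>0$ (that is, $f_v-\frac\mu2\|\cdot\|^2$ is convex), that $\|\nabla f_v(x^*)\|^2\le\sigma_*^2$ for all $v$ with $\sigma_*>0$, and that $x^0\ne x^*$. Run the algorithm for $T$ iterations with $$\gamma=\min\Big\{\frac1{\bar L},\ \frac1{T\mu}\ln\Big(T\,\frac{\|x^0-x^*\|^2\mu^2}{\tau_{mix}\sigma_*^2\bar L}\Big)\Big\}.$$ Then $$\mathbb E\|x^T-x^*\|^2\le\tilde{\mathcal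 O}\Big(\frac{\bar L^2\tau_{mix}\sigma_*^2}{L_{\min}T}\Big)+\mathcal O\big(p_J^2\|P_{IS}-P_{\text{Lévy}}\|_1^2\big)$$ in the following sense: the right-hand side is $$C_1(\ln T)^k\,\frac{\bar L^2\tau_{mix}\sigma_*^2}{L_{\min}T}+C_2\,p_J^2\|P_{IS}-P_{\text{Lévy}}\|_1^2 ,$$ with an absolute exponent $k$, a constant $C_1$ depending only on $\mu$, and a constant $C_2$ depending only on $G$, $(L_v)_v$, $\mu$ and $\sigma_*$, and the bound holds for all $T\ge T_0$, where $T_0$ depends only on $G$, $(L_v)_v$, $\mu$, $\sigma_*$, $p_d$, $r$, the form of $P_{\text{Lévy}}$ and $\|x^0-x^*\|$ (in particular not on $p_J$, the dimension $d$, the losses, or the initial distribution of the walk). -/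

import Mathlib

open MeasureTheory

namespace MHLJ

noncomputable section

section Graph

variable {V : Type*} [Fintype V] [DecidableEq V]

/-- Adjacency matrix of the communication graph, in which every node carries a self-loop. -/
def adj (G : SimpleGraph V) [DecidableRel G.Adj] : Matrix V V ℝ :=
  G.adjMatrix ℝ + 1

/-- Degree of a node, its self-loop included (the row sum of `adj G`). -/
def deg (G : SimpleGraph V) [DecidableRel G.Adj] (v : V) : ℝ :=
  ∑ u, adj G v u

/-- The average `(1 / |V|) ∑ L_v` of the smoothness constants. -/
def meanL (L : V → ℝ) : ℝ := (∑ v, L v) / Fintype.card V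

/-- The smallest smoothness constant. -/
def minL (L : V → ℝ) : ℝ := ⨅ v, L v

/-- Off-diagonal entries of the Metropolis-Hastings transition matrix whose proposal is the simple
random walk and whose target distribution is proportional to `L`. -/
def misOff (G : SimpleGraph V) [DecidableRel G.Adj] (L : V → ℝ) (i j : V) : ℝ :=
  if G.Adj i j then 1 / deg G i * min 1 (deg G i * L j / (deg G j * L i)) else 0

/-- The Metropolis-Hastings importance sampling matrix `P_IS`. (`G.Adj` is irreflexive, so the sum
on the diagonal runs over the neighbours other than `i`.) -/
def PIS (G : SimpleGraph V) [DecidableRel G.Adj] (L : V → ℝ) : Matrix V V ℝ :=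
  Matrix.of fun i j => if i = j then 1 - ∑ k, misOff G L i k else misOff G L i j

/-- Truncated geometric probability of a jump of length `i`, for `1 ≤ i ≤ r`. -/
def truncGeom (pd : ℝ) (r i : ℕ) : ℝ :=
  pd * (1 - pd) ^ (i - 1) / (1 - (1 - pd) ^ r)

/-- The closed form `∑_{i=1}^r truncGeom i • diag(A^i 1)⁻¹ A^i` of the Lévy jump matrix. -/
def levyClosed (G : SimpleGraph V) [DecidableRel G.Adj] (pd : ℝ) (r : ℕ) : Matrix V V ℝ :=
  ∑ i ∈ Finset.Icc 1 r, truncGeom pd r i •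
    (Matrix.diagonal (fun v => (∑ u, (adj G ^ i) v u)⁻¹) * adj G ^ i)

/-- The Lévy jump matrix of the algorithm as it is run: a truncated geometric number of
successive moves, each to a uniformly chosen neighbour. -/
def levyWalk (G : SimpleGraph V) [DecidableRel G.Adj] (pd : ℝ) (r : ℕ) : Matrix V V ℝ :=
  ∑ i ∈ Finset.Icc 1 r, truncGeom pd r i •
    (Matrix.diagonal (fun v => (deg G v)⁻¹) * adj G) ^ i

/-- The perturbed transition matrix `(1 - p_J) P_IS + p_J P_Lévy`. -/
def perturbed (pJ : ℝ) (P Q : Matrix V V ℝ) : Matrix V V ℝ := (1 - pJ) • P + pJ • Q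

/-- The operator norm of `M` acting on row vectors with the `ℓ¹` norm, that is, the largest
absolute row sum. -/
def norm1 (M : Matrix V V ℝ) : ℝ := ⨆ i, ∑ j, |M i j|

/-- `ν` is a stationary probability distribution of `P`. -/
structure IsStationary (P : Matrix V V ℝ) (ν : V → ℝ) : Prop where
  nonneg : ∀ v, 0 ≤ ν v
  sum_eq_one : ∑ v, ν v = 1
  stationary : Matrix.vecMul ν P = ν

/-- Mixing time of a chain with transition matrix `P` and stationary distribution `ν`: the first
time at which the total variation distance to `ν` is at most `1/4` from every starting point. -/
def mixingTime (P : Matrix V V ℝ) (ν : V → ℝ) : ℕ :=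
  sInf {t : ℕ | ∀ v, (1 / 2 : ℝ) * ∑ u, |(P ^ t) v u - ν u| ≤ 1 / 4}

/-- `X` is a time-homogeneous Markov chain on `V` with transition matrix `P` and an arbitrary
initial distribution (given through its finite-dimensional distributions). -/
structure IsMarkovChain {Ω : Type*} [MeasurableSpace Ω] (ℙ : Measure Ω)
    (P : Matrix V V ℝ) (X : ℕ → Ω → V) : Prop where
  measurable : ∀ t a, MeasurableSet {ω | X t ω = a}
  law : ∀ (t : ℕ) (a : ℕ → V),
    ℙ.real {ω | ∀ i ≤ t, X i ω = a i} =
      ℙ.real {ω | X 0 ω = a 0} * ∏ i ∈ Finset.range t, P (a i) (a (i + 1))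

end Graph

section Optimization

variable {E : Type*} [NormedAddCommGroup E] [InnerProductSpace ℝ E] [CompleteSpace E]

/-- `f` is differentiable with `K`-Lipschitz gradient. -/
structure IsSmooth (K : ℝ) (f : E → ℝ) : Prop where
  differentiable : Differentiable ℝ f
  lipschitz : ∀ x y, ‖gradient f x - gradient f y‖ ≤ K * ‖x - y‖

/-- The model after `t` updates `x ↦ x - γ (L̄ / L_{v_t}) ∇ f_{v_t} (x)` along the node
sequence `v`. -/
def iterate {V : Type*} [Fintype V] (γ : ℝ) (L : V → ℝ) (f : V → E → ℝ) (x₀ : E) (v : ℕ → V) :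
    ℕ → E
  | 0 => x₀
  | t + 1 => iterate γ L f x₀ v t -
      (γ * (meanL L / L (v t))) • gradient (f (v t)) (iterate γ L f x₀ v t)

end Optimization

/-- The step size `min {1 / L̄, (1 / (T μ)) ln (T D² μ² / (τ σ² L̄))}`. -/
def stepSize (Lbar μ σ D : ℝ) (τ T : ℕ) : ℝ :=
  min (1 / Lbar) (1 / (T * μ) * Real.log (T * (D ^ 2 * μ ^ 2 / (τ * σ ^ 2 * Lbar))))

end

end MHLJ

/-! Metropolis–Hastings makes `PIS` stationary at `π ∝ L`, and under `π` the weighted gradients `(L̄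
/ L_v) ∇f_v` average exactly to the gradient of the mean loss. MHLJ is thus stochastic approximation
with Markovian noise and a small bias: its chain equilibrates at `ν`, not at `π`. Put `ε = p_J ‖P_IS
- P_Lévy‖₁`.

The bias is linear in `ε`: `sum_abs_stationary_sub_le` gives `‖ν - π‖₁ ≤ 2 m₀ ε`, where `m₀` is a
time by which `PIS` alone has mixed. Hence `m₀`, and with it `C₂`, involves only `G` and `L` and no
jump parameter.

The noise is handled by looking back `s = m τ` steps with `2⁻ᵐ ≤ 1/T`. Given the past up to time
`t`, the law of `v_{t+s}` is within `2 ⋅ 2⁻ᵐ + 2 m₀ ε` of `π`, while the iterate has moved only by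
order `s γ` in between. `IsMonotoneField.integral_step_le` turns this into a contraction by `1 - γ
μ` with an error of order `γ (s γ + η²)`, `η` being the distance to `π`. Young's inequality makes
the bias enter squared. Since `s` and `γ T` are logarithmic in `T` up to the factors `τ` and `1/μ`,
summation gives the claimed rate.

This needs `ε` below a threshold `ε₀`. Above it no mixing is used: every `f_v` is strongly convex,
so each step contracts along each path, the error is eventually bounded by a constant, and that
constant is at most a multiple of `ε²`.

A Doeblin bound uniform in `p_J` (`exists_perturbed_mixing`) bounds all the mixing times at once, so
`T₀` does not depend on `p_J`. -/

namespace MHLJ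

open Matrix Finset

/-! ### Stochastic matrices: contraction, perturbation and mixing times -/

section Stochastic

variable {V : Type*} [Fintype V]

lemma sum_abs_vecMul_le {M : Matrix V V ℝ} {c : ℝ} (hM : ∀ i, ∑ j, |M i j| ≤ c) (ρ : V → ℝ) :
    ∑ j, |(ρ ᵥ* M) j| ≤ c * ∑ i, |ρ i| := by
  calc ∑ j, |(ρ ᵥ* M) j| ≤ ∑ j, ∑ i, |ρ i| * |M i j| := by
        refine sum_le_sum fun j _ => ?_
        simp only [vecMul, dotProduct]
        exact (abs_sum_le_sum_abs _ _).trans_eq (sum_congr rfl fun i _ => abs_mul _ _)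
    _ = ∑ i, |ρ i| * ∑ j, |M i j| := by rw [sum_comm]; simp_rw [mul_sum]
    _ ≤ ∑ i, |ρ i| * c := sum_le_sum fun i _ => mul_le_mul_of_nonneg_left (hM i) (abs_nonneg _)
    _ = c * ∑ i, |ρ i| := by rw [← sum_mul, mul_comm]

lemma IsStationary.sum_abs_eq {P : Matrix V V ℝ} {ν : V → ℝ} (h : IsStationary P ν) :
    ∑ v, |ν v| = 1 := by
  rw [← h.sum_eq_one]
  exact sum_congr rfl fun j _ => abs_of_nonneg (h.nonneg j)

/-- On vectors of total mass zero a matrix acts as its difference with any rank one matrix whose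
rows agree. -/
lemma sum_abs_vecMul_le_of_sub {M : Matrix V V ℝ} {c : ℝ} (ν : V → ℝ)
    (hM : ∀ i, ∑ j, |M i j - ν j| ≤ c) {ρ : V → ℝ} (hρ : ∑ i, ρ i = 0) :
    ∑ j, |(ρ ᵥ* M) j| ≤ c * ∑ i, |ρ i| := by
  have h := sum_abs_vecMul_le (M := Matrix.of fun i j => M i j - ν j) (c := c) hM ρ
  convert h using 3 with j
  simp only [vecMul, dotProduct, of_apply, mul_sub, sum_sub_distrib, ← sum_mul, hρ]
  simp

variable [DecidableEq V]

lemma sum_vecMul_eq {P : Matrix V V ℝ} (hP : P ∈ rowStochastic ℝ V) (ρ : V → ℝ) :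
    ∑ j, (ρ ᵥ* P) j = ∑ i, ρ i := by
  simp only [vecMul, dotProduct]
  rw [sum_comm]
  exact sum_congr rfl fun i _ => by
    rw [← mul_sum, sum_row_of_mem_rowStochastic hP, mul_one]

lemma sum_abs_row {P : Matrix V V ℝ} (hP : P ∈ rowStochastic ℝ V) (i : V) :
    ∑ j, |P i j| = 1 := by
  rw [← sum_row_of_mem_rowStochastic hP i]
  exact sum_congr rfl fun j _ => abs_of_nonneg (nonneg_of_mem_rowStochastic hP)

lemma sum_abs_vecMul_pow_le {M : Matrix V V ℝ} (hMs : M ∈ rowStochastic ℝ V) {q : ℝ} (hq : 0 ≤ q)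
    (hM : ∀ ρ : V → ℝ, ∑ i, ρ i = 0 → ∑ j, |(ρ ᵥ* M) j| ≤ q * ∑ i, |ρ i|) (k : ℕ)
    {ρ : V → ℝ} (hρ : ∑ i, ρ i = 0) :
    ∑ j, |(ρ ᵥ* M ^ k) j| ≤ q ^ k * ∑ i, |ρ i| := by
  induction k with
  | zero => simp
  | succ k ih =>
    rw [pow_succ, ← vecMul_vecMul]
    refine (hM _ ?_).trans ?_
    · rw [sum_vecMul_eq (pow_mem hMs k), hρ]
    · rw [pow_succ, mul_comm (q ^ k) q, mul_assoc]
      exact mul_le_mul_of_nonneg_left ih hq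

lemma IsStationary.vecMul_pow {P : Matrix V V ℝ} {ν : V → ℝ} (h : IsStationary P ν) (k : ℕ) :
    ν ᵥ* P ^ k = ν := by
  induction k with
  | zero => simp
  | succ k ih => rw [pow_succ, ← vecMul_vecMul, ih, h.stationary]

lemma IsStationary.pow {P : Matrix V V ℝ} {ν : V → ℝ} (h : IsStationary P ν) (k : ℕ) :
    IsStationary (P ^ k) ν :=
  ⟨h.nonneg, h.sum_eq_one, h.vecMul_pow k⟩

/-- Geometric convergence to the stationary distribution. -/
lemma IsStationary.sum_abs_pow_sub_le {M : Matrix V V ℝ} {ν : V → ℝ} (h : IsStationary M ν)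
    (hMs : M ∈ rowStochastic ℝ V) {q : ℝ} (hq : 0 ≤ q)
    (hM : ∀ ρ : V → ℝ, ∑ i, ρ i = 0 → ∑ j, |(ρ ᵥ* M) j| ≤ q * ∑ i, |ρ i|) (k : ℕ) (v : V) :
    ∑ u, |(M ^ k) v u - ν u| ≤ 2 * q ^ k := by
  have hρ : ∑ i, (Pi.single v (1 : ℝ) - ν : V → ℝ) i = 0 := by
    simp [sum_sub_distrib, h.sum_eq_one]
  have h1 : ∑ i, |(Pi.single v (1 : ℝ) - ν : V → ℝ) i| ≤ 2 := by
    calc ∑ i, |(Pi.single v (1 : ℝ) - ν : V → ℝ) i|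
        ≤ ∑ i, (|(Pi.single v (1 : ℝ) : V → ℝ) i| + |ν i|) :=
          sum_le_sum fun i _ => abs_sub _ _
      _ = 2 := by
          rw [sum_add_distrib, h.sum_abs_eq]
          have : ∑ i, |(Pi.single v (1 : ℝ) : V → ℝ) i| = 1 := by
            rw [Finset.sum_eq_single v] <;> simp +contextual
          rw [this]; norm_num
  have h2 := sum_abs_vecMul_pow_le hMs hq hM k hρ
  have h3 : (Pi.single v (1 : ℝ) - ν : V → ℝ) ᵥ* M ^ k = fun u => (M ^ k) v u - ν u := by
    rw [sub_vecMul, h.vecMul_pow]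
    ext u
    simp
  rw [h3] at h2
  calc _ ≤ q ^ k * ∑ i, |(Pi.single v (1 : ℝ) - ν : V → ℝ) i| := h2
    _ ≤ q ^ k * 2 := mul_le_mul_of_nonneg_left h1 (pow_nonneg hq k)
    _ = 2 * q ^ k := mul_comm _ _

/-- Total variation `1/4` is `ℓ¹` distance `1/2`, so `P ^ t` halves every vector of total mass zero,
and `m` blocks of length `t` give `2⁻ᵐ`. -/
lemma IsStationary.sum_abs_pow_mul_sub_le {P : Matrix V V ℝ} {ν : V → ℝ} (h : IsStationary P ν)
    (hP : P ∈ rowStochastic ℝ V) {t : ℕ} (ht : ∀ v, ∑ u, |(P ^ t) v u - ν u| ≤ 1 / 2)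
    (m : ℕ) (v : V) :
    ∑ u, |(P ^ (m * t)) v u - ν u| ≤ 2 * (1 / 2) ^ m := by
  rw [mul_comm, pow_mul]
  exact (h.pow t).sum_abs_pow_sub_le (pow_mem hP t) (by norm_num)
    (fun ρ hρ => sum_abs_vecMul_le_of_sub ν ht hρ) m v

/-- Stationary distributions depend on the transition matrix in a Lipschitz way. -/
lemma sum_abs_stationary_sub_le {P Q : Matrix V V ℝ} {π ν : V → ℝ} (hP : P ∈ rowStochastic ℝ V)
    (hπ : IsStationary P π) (hν : IsStationary Q ν) {m : ℕ}
    (hm : ∀ v, ∑ u, |(P ^ m) v u - π u| ≤ 1 / 2) {e : ℝ} (he : ∀ i, ∑ j, |(Q - P) i j| ≤ e) :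
    ∑ v, |ν v - π v| ≤ 2 * m * e := by
  -- `ν - π` is almost fixed by `P`: the defect is `ν (Q - P)`, of norm at most `e`, and each
  -- further power of `P` adds one such defect. As `P ^ m` also halves `ν - π`, the other half has
  -- norm at most `m e`.
  have hdec : ∀ k : ℕ, ∑ v, |((ν - π) ᵥ* P ^ k) v - (ν - π) v| ≤ k * e := by
    intro k
    induction k with
    | zero => simp
    | succ k ih =>
      have h1 : ∀ v, ((ν - π) ᵥ* P ^ (k + 1)) v - (ν - π) v =
          (((ν - π) ᵥ* P ^ k) v - (ν - π) v) - ((ν ᵥ* (Q - P)) ᵥ* P ^ k) v := by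
        intro v
        rw [pow_succ', ← vecMul_vecMul, vecMul_sub, hν.stationary, sub_vecMul (A := P),
          hπ.stationary]
        simp only [sub_vecMul, Pi.sub_apply]; ring
      have h2 : ∑ v, |((ν ᵥ* (Q - P)) ᵥ* P ^ k) v| ≤ e := by
        refine (sum_abs_vecMul_le (c := 1) (fun i => (sum_abs_row (pow_mem hP k) i).le) _).trans ?_
        rw [one_mul]
        simpa [hν.sum_abs_eq] using sum_abs_vecMul_le he ν
      calc _ ≤ ∑ v, (|((ν - π) ᵥ* P ^ k) v - (ν - π) v| + |((ν ᵥ* (Q - P)) ᵥ* P ^ k) v|) :=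
            sum_le_sum fun v _ => by rw [h1]; exact abs_sub _ _
        _ ≤ k * e + e := by rw [sum_add_distrib]; exact add_le_add ih h2
        _ = _ := by push_cast; ring
  have h0 : ∑ i, (ν - π) i = 0 := by
    simp [sum_sub_distrib, hν.sum_eq_one, hπ.sum_eq_one]
  have h1 := sum_abs_vecMul_le_of_sub π hm h0
  have h2 : ∑ v, |(ν - π) v| ≤ ∑ v, |((ν - π) ᵥ* P ^ m) v| + m * e := by
    refine le_trans ?_ (add_le_add le_rfl (hdec m))
    rw [← sum_add_distrib]
    refine sum_le_sum fun v _ => ?_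
    rw [abs_sub_comm]
    have := abs_add_le (((ν - π) ᵥ* P ^ m) v) ((ν - π) v - ((ν - π) ᵥ* P ^ m) v)
    simpa using this
  simp only [Pi.sub_apply] at h1 h2
  linarith

/-- Holding at a vertex pads short walks, so one exponent `n` serves all pairs of vertices. -/
lemma pow_le_pow_apply_of_walk {G : SimpleGraph V} {P : Matrix V V ℝ}
    (hP : P ∈ rowStochastic ℝ V) {c : ℝ} (hc : 0 ≤ c) (hd : ∀ i, c ≤ P i i)
    (ho : ∀ i j, G.Adj i j → c ≤ P i j) (n : ℕ) :
    ∀ {i j : V} (w : G.Walk i j), w.length ≤ n → c ^ n ≤ (P ^ n) i j := by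
  have key : ∀ (n : ℕ) (i k j : V), P i k * (P ^ n) k j ≤ (P ^ (n + 1)) i j := by
    intro n i k j
    rw [pow_succ', mul_apply]
    exact single_le_sum (f := fun k => P i k * (P ^ n) k j)
      (fun l _ => mul_nonneg (nonneg_of_mem_rowStochastic hP)
        (nonneg_of_mem_rowStochastic (pow_mem hP n))) (mem_univ k)
  induction n with
  | zero =>
    intro i j w hw
    have := SimpleGraph.Walk.eq_of_length_eq_zero (Nat.le_zero.1 hw)
    subst this
    simp
  | succ n ih =>
    intro i j w hw
    cases w with
    | nil =>
      rw [pow_succ']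
      exact (mul_le_mul (hd i) (ih .nil (by simp)) (pow_nonneg hc n)
        (nonneg_of_mem_rowStochastic hP)).trans (key n i i i)
    | cons h w =>
      rw [pow_succ']
      refine (mul_le_mul (ho _ _ h) (ih w ?_) (pow_nonneg hc n)
        (nonneg_of_mem_rowStochastic hP)).trans (key n _ _ _)
      simpa using hw

/-- A uniform bound for the mixing times of all chains that follow each edge, and stay, with
probability at least `c`. -/
theorem exists_uniform_mixing [Nonempty V] {G : SimpleGraph V} (hG : G.Connected) {c : ℝ}
    (hc : 0 < c) :
    ∃ N : ℕ, ∀ P ∈ rowStochastic ℝ V, (∀ i, c ≤ P i i) → (∀ i j, G.Adj i j → c ≤ P i j) →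
      ∀ ν, IsStationary P ν → ∀ v, ∑ u, |(P ^ N) v u - ν u| ≤ 1 / 2 := by
  set n := Fintype.card V with hn
  have hn0 : 0 < (n : ℝ) := by exact_mod_cast Fintype.card_pos
  -- Doeblin coefficient: all entries of `P ^ n` are at least `c ^ n`, because a path has length
  -- below `n = |V|`. The maximum with `0` covers values of `c` too large for any admissible `P` to
  -- exist.
  set q : ℝ := max 0 (1 - n * c ^ n) with hqd
  have hq0 : 0 ≤ q := le_max_left _ _
  have hq1 : q < 1 := by
    refine max_lt one_pos ?_
    have : 0 < n * c ^ n := by positivity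
    linarith
  obtain ⟨m, hm⟩ := exists_pow_lt_of_lt_one (show (0 : ℝ) < 1 / 4 by norm_num) hq1
  refine ⟨n * m, fun P hP hd ho ν hν v => ?_⟩
  have hlow : ∀ i j, c ^ n ≤ (P ^ n) i j := by
    intro i j
    obtain ⟨p⟩ := hG.preconnected i j
    exact pow_le_pow_apply_of_walk hP hc.le hd ho n (p.bypass)
      (p.bypass_isPath.length_lt).le
  have hcon : ∀ ρ : V → ℝ, ∑ i, ρ i = 0 → ∑ j, |(ρ ᵥ* P ^ n) j| ≤ q * ∑ i, |ρ i| := by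
    intro ρ hρ
    refine sum_abs_vecMul_le_of_sub (fun _ => c ^ n) (fun i => ?_) hρ
    refine le_trans (le_of_eq ?_) (le_max_right _ _)
    calc ∑ j, |(P ^ n) i j - c ^ n| = ∑ j, ((P ^ n) i j - c ^ n) :=
          sum_congr rfl fun j _ => abs_of_nonneg (sub_nonneg.2 (hlow i j))
      _ = _ := by
        rw [sum_sub_distrib, sum_row_of_mem_rowStochastic (pow_mem hP n)]
        simp [hn]
  rw [pow_mul]
  refine ((hν.pow n).sum_abs_pow_sub_le (pow_mem hP n) hq0 hcon m v).trans ?_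
  linarith

lemma mixingTime_le {P : Matrix V V ℝ} {ν : V → ℝ} {N : ℕ}
    (h : ∀ v, ∑ u, |(P ^ N) v u - ν u| ≤ 1 / 2) : mixingTime P ν ≤ N :=
  Nat.sInf_le fun v => by linarith [h v]

/-- The witness `N` makes the set of admissible times nonempty, so the infimum is attained and is
not the default `0` of `sInf ∅`. -/
lemma mixingTime_spec {P : Matrix V V ℝ} {ν : V → ℝ} {N : ℕ}
    (h : ∀ v, ∑ u, |(P ^ N) v u - ν u| ≤ 1 / 2) (v : V) :
    ∑ u, |(P ^ mixingTime P ν) v u - ν u| ≤ 1 / 2 := by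
  have : mixingTime P ν ∈ {t : ℕ | ∀ v, (1 / 2 : ℝ) * ∑ u, |(P ^ t) v u - ν u| ≤ 1 / 4} :=
    Nat.sInf_mem ⟨N, fun v => by linarith [h v]⟩
  linarith [this v]

/-- At time `0` the rows are point masses; being close to all of them would give every vertex
`ν`-mass at least `3/4`, impossible with two vertices. -/
lemma one_le_mixingTime [Nontrivial V] {P : Matrix V V ℝ} {ν : V → ℝ} {N : ℕ}
    (hν : ∑ v, ν v = 1) (h : ∀ v, ∑ u, |(P ^ N) v u - ν u| ≤ 1 / 2) : 1 ≤ mixingTime P ν := by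
  by_contra hlt
  have h0 : mixingTime P ν = 0 := by omega
  have hs := mixingTime_spec h
  rw [h0, pow_zero] at hs
  have hv : ∀ v, 3 / 4 ≤ ν v := by
    intro v
    have h1 : |(1 : Matrix V V ℝ) v v - ν v| +
        ∑ u ∈ univ.erase v, |(1 : Matrix V V ℝ) v u - ν u| ≤ 1 / 2 := by
      rw [add_sum_erase _ (fun u => |(1 : Matrix V V ℝ) v u - ν u|) (mem_univ v)]
      exact hs v
    have h2 : ∑ u ∈ univ.erase v, ν u ≤
        ∑ u ∈ univ.erase v, |(1 : Matrix V V ℝ) v u - ν u| := by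
      refine sum_le_sum fun u hu => ?_
      rw [one_apply_ne (ne_of_mem_erase hu).symm, zero_sub, abs_neg]
      exact le_abs_self _
    have h3 : ν v + ∑ u ∈ univ.erase v, ν u = 1 := by
      rw [add_sum_erase _ _ (mem_univ v), hν]
    have h4 := le_abs_self ((1 : Matrix V V ℝ) v v - ν v)
    rw [one_apply_eq] at h4 h1
    linarith
  have h5 : ∑ _v : V, (3 / 4 : ℝ) ≤ ∑ v, ν v := sum_le_sum fun v _ => hv v
  have h6 : (2 : ℝ) ≤ Fintype.card V := by exact_mod_cast Fintype.one_lt_card (α := V)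
  rw [hν, sum_const, card_univ, nsmul_eq_mul] at h5
  linarith

end Stochastic

/-! ### The perturbation measured in the row-sum norm -/

section Norm

variable {V : Type*} [Fintype V]

lemma sum_abs_le_norm1 (M : Matrix V V ℝ) (i : V) : ∑ j, |M i j| ≤ norm1 M :=
  le_ciSup (f := fun i => ∑ j, |M i j|) (Set.finite_range _).bddAbove i

lemma norm1_nonneg (M : Matrix V V ℝ) : 0 ≤ norm1 M :=
  Real.iSup_nonneg fun _ => sum_nonneg fun _ _ => abs_nonneg _

lemma sum_abs_perturbed_sub_le (P Q : Matrix V V ℝ) {p : ℝ} (h0 : 0 ≤ p) (i : V) :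
    ∑ j, |(perturbed p P Q - P) i j| ≤ p * norm1 (P - Q) := by
  calc ∑ j, |(perturbed p P Q - P) i j| = ∑ j, p * |(P - Q) i j| := by
        refine sum_congr rfl fun j _ => ?_
        have : (perturbed p P Q - P) i j = -(p * (P - Q) i j) := by
          simp [perturbed]; ring
        rw [this, abs_neg, abs_mul, abs_of_nonneg h0]
    _ ≤ _ := by rw [← mul_sum]; exact mul_le_mul_of_nonneg_left (sum_abs_le_norm1 _ i) h0

end Norm

/-! ### The Metropolis–Hastings and Lévy matrices, and their uniform mixing -/

section Transition

variable {V : Type*} [DecidableEq V] (G : SimpleGraph V) [DecidableRel G.Adj]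

lemma adj_nonneg (i j : V) : 0 ≤ adj G i j := by
  simp only [adj, Matrix.add_apply, SimpleGraph.adjMatrix_apply, one_apply]
  split_ifs <;> norm_num

lemma adj_self (i : V) : adj G i i = 1 := by simp [adj]

variable {G} in
lemma adj_of_adj {i j : V} (h : G.Adj i j) : adj G i j = 1 := by
  simp [adj, h, one_apply_ne h.ne]

variable [Fintype V]

lemma deg_eq_sum (i : V) : deg G i = 1 + ∑ j, if G.Adj i j then (1 : ℝ) else 0 := by
  simp [deg, adj, sum_add_distrib, one_apply, add_comm]

lemma one_le_deg (i : V) : 1 ≤ deg G i := by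
  rw [deg_eq_sum]
  linarith [sum_nonneg fun j (_ : j ∈ (univ : Finset V)) =>
    show (0 : ℝ) ≤ if G.Adj i j then 1 else 0 by split_ifs <;> norm_num]

lemma deg_pos (i : V) : 0 < deg G i := one_pos.trans_le (one_le_deg G i)

lemma misOff_nonneg {L : V → ℝ} (hL : ∀ v, 0 < L v) (i j : V) : 0 ≤ misOff G L i j := by
  have h1 := deg_pos G i
  have h2 := deg_pos G j
  have h3 := hL i
  have h4 := hL j
  unfold misOff
  split_ifs <;> positivity

variable {G} in
lemma misOff_pos {L : V → ℝ} (hL : ∀ v, 0 < L v) {i j : V} (h : G.Adj i j) :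
    0 < misOff G L i j := by
  have h1 := deg_pos G i
  have h2 := deg_pos G j
  have h3 := hL i
  have h4 := hL j
  rw [misOff, if_pos h]
  positivity

/-- Only `deg G i - 1` proposals leave `i`, each accepted with probability at most `1`. The
remaining `1 / deg G i` keeps the diagonal of `PIS` positive, hence the chain aperiodic. -/
lemma sum_misOff_le (L : V → ℝ) (i : V) : ∑ j, misOff G L i j ≤ 1 - 1 / deg G i := by
  have h1 := deg_pos G i
  calc ∑ j, misOff G L i j ≤ ∑ j, 1 / deg G i * (if G.Adj i j then (1 : ℝ) else 0) := by
        refine sum_le_sum fun j _ => ?_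
        unfold misOff
        split_ifs
        · exact mul_le_mul_of_nonneg_left (min_le_left _ _) (by positivity)
        · simp
    _ = 1 / deg G i * (deg G i - 1) := by rw [← mul_sum, deg_eq_sum]; ring
    _ = _ := by field_simp

lemma misOff_self (L : V → ℝ) (i : V) : misOff G L i i = 0 := by simp [misOff]

lemma PIS_eq (L : V → ℝ) (i j : V) :
    PIS G L i j = misOff G L i j + if i = j then 1 - ∑ k, misOff G L i k else 0 := by
  by_cases h : i = j
  · subst h; simp [PIS, misOff_self]
  · simp [PIS, h]

lemma PIS_mem_rowStochastic {L : V → ℝ} (hL : ∀ v, 0 < L v) :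
    PIS G L ∈ rowStochastic ℝ V := by
  rw [mem_rowStochastic_iff_sum]
  refine ⟨fun i j => ?_, fun i => ?_⟩
  · rw [PIS_eq]
    refine add_nonneg (misOff_nonneg G hL i j) ?_
    split_ifs
    · have := sum_misOff_le G L i
      have h2 : 0 ≤ 1 / deg G i := by have := deg_pos G i; positivity
      linarith
    · exact le_rfl
  · simp [PIS_eq, sum_add_distrib]

lemma PIS_self_pos (L : V → ℝ) (i : V) : 0 < PIS G L i i := by
  rw [PIS_eq, misOff_self, if_pos rfl]
  have := sum_misOff_le G L i
  have h2 : 0 < 1 / deg G i := by have := deg_pos G i; positivity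
  linarith

variable {G} in
lemma PIS_pos_of_adj {L : V → ℝ} (hL : ∀ v, 0 < L v) {i j : V} (h : G.Adj i j) :
    0 < PIS G L i j := by
  rw [PIS_eq, if_neg h.ne, add_zero]
  exact misOff_pos hL h

/-- Detailed balance of the Metropolis-Hastings chain. -/
lemma mul_misOff_comm {L : V → ℝ} (hL : ∀ v, 0 < L v) (i j : V) :
    L i * misOff G L i j = L j * misOff G L j i := by
  -- The flow from `i` to `j` in a form that is visibly symmetric.
  have key : ∀ i j, L i * (1 / deg G i * min 1 (deg G i * L j / (deg G j * L i))) =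
      min (L i / deg G i) (L j / deg G j) := by
    intro i j
    have h1 := deg_pos G i
    have h2 := deg_pos G j
    have h3 := hL i
    have h4 := hL j
    rw [← mul_assoc, mul_min_of_nonneg _ _ (by positivity)]
    congr 1
    · ring
    · field_simp
  unfold misOff
  by_cases h : G.Adj i j
  · rw [if_pos h, if_pos h.symm, key, key, min_comm]
  · rw [if_neg h, if_neg (fun h' => h h'.symm)]; simp

/-- The Metropolis-Hastings chain is stationary at its target, the distribution
proportional to `L`. -/
lemma isStationary_PIS [Nonempty V] {L : V → ℝ} (hL : ∀ v, 0 < L v) :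
    IsStationary (PIS G L) (fun v => L v / ∑ u, L u) := by
  have hs : 0 < ∑ u, L u := sum_pos (fun u _ => hL u) univ_nonempty
  refine ⟨fun v => by have := hL v; positivity, ?_, ?_⟩
  · rw [← sum_div, div_self hs.ne']
  · ext j
    have h1 : ∀ i, L i * PIS G L i j = L j * PIS G L j i := by
      intro i
      rw [PIS_eq, PIS_eq, mul_add, mul_add, mul_misOff_comm G hL]
      by_cases h : i = j
      · subst h; rfl
      · rw [if_neg h, if_neg (fun h' => h h'.symm)]; simp
    simp only [vecMul, dotProduct]
    calc ∑ i, L i / (∑ u, L u) * PIS G L i j = (∑ i, L j * PIS G L j i) / ∑ u, L u := by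
          rw [sum_div]
          exact sum_congr rfl fun i _ => by rw [← h1]; ring
      _ = _ := by
          rw [← mul_sum, sum_row_of_mem_rowStochastic (PIS_mem_rowStochastic G hL), mul_one]

lemma truncGeom_nonneg {pd : ℝ} (h0 : 0 < pd) (h1 : pd ≤ 1) (r i : ℕ) : 0 ≤ truncGeom pd r i := by
  have h2 : 0 ≤ 1 - pd := by linarith
  have h3 : (1 - pd) ^ r ≤ 1 := pow_le_one₀ h2 (by linarith)
  have h4 : 0 ≤ 1 - (1 - pd) ^ r := by linarith
  unfold truncGeom
  positivity

lemma one_sub_pow_pos {pd : ℝ} (h0 : 0 < pd) (h1 : pd ≤ 1) {r : ℕ} (hr : 1 ≤ r) :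
    0 < 1 - (1 - pd) ^ r := by
  have := pow_lt_one₀ (show 0 ≤ 1 - pd by linarith) (by linarith) (Nat.one_le_iff_ne_zero.1 hr)
  linarith

lemma truncGeom_one_pos {pd : ℝ} (h0 : 0 < pd) (h1 : pd ≤ 1) {r : ℕ} (hr : 1 ≤ r) :
    0 < truncGeom pd r 1 := by
  have := one_sub_pow_pos h0 h1 hr
  unfold truncGeom
  simp only [Nat.sub_self, pow_zero, mul_one]
  positivity

lemma sum_truncGeom {pd : ℝ} (h0 : 0 < pd) (h1 : pd ≤ 1) {r : ℕ} (hr : 1 ≤ r) :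
    ∑ i ∈ Icc 1 r, truncGeom pd r i = 1 := by
  have h := one_sub_pow_pos h0 h1 hr
  have h2 : ∑ i ∈ Icc 1 r, (1 - pd) ^ (i - 1) = ∑ i ∈ range r, (1 - pd) ^ i := by
    have : Icc 1 r = Ico 1 (r + 1) := by ext; simp
    rw [this, sum_Ico_eq_sum_range]
    simp
  unfold truncGeom
  rw [← sum_div, ← mul_sum, h2, div_eq_one_iff_eq h.ne']
  have := mul_neg_geom_sum (1 - pd) r
  rw [sub_sub_cancel] at this
  exact this

lemma sum_smul_mem_rowStochastic {ι : Type*} {s : Finset ι} {w : ι → ℝ} {M : ι → Matrix V V ℝ}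
    (hw : ∀ i ∈ s, 0 ≤ w i) (hs : ∑ i ∈ s, w i = 1) (hM : ∀ i ∈ s, M i ∈ rowStochastic ℝ V) :
    ∑ i ∈ s, w i • M i ∈ rowStochastic ℝ V :=
  convex_rowStochastic.sum_mem hw hs hM

lemma smul_apply_le_sum {ι : Type*} {s : Finset ι} {w : ι → ℝ} {M : ι → Matrix V V ℝ}
    (hw : ∀ i ∈ s, 0 ≤ w i) (hM : ∀ i ∈ s, M i ∈ rowStochastic ℝ V) {k : ι} (hk : k ∈ s) (i j : V) :
    w k * M k i j ≤ (∑ i ∈ s, w i • M i) i j := by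
  rw [Matrix.sum_apply]
  simp only [Matrix.smul_apply, smul_eq_mul]
  exact single_le_sum (f := fun k => w k * M k i j)
    (fun l hl => mul_nonneg (hw l hl) (nonneg_of_mem_rowStochastic (hM l hl))) hk

lemma normalize_mem_rowStochastic {M : Matrix V V ℝ} (h0 : ∀ i j, 0 ≤ M i j)
    (hd : ∀ i, 0 < M i i) :
    Matrix.diagonal (fun v => (∑ u, M v u)⁻¹) * M ∈ rowStochastic ℝ V := by
  have hpos : ∀ v, 0 < ∑ u, M v u := fun v =>
    sum_pos' (fun u _ => h0 v u) ⟨v, mem_univ v, hd v⟩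
  rw [mem_rowStochastic_iff_sum]
  refine ⟨fun i j => ?_, fun i => ?_⟩
  · rw [diagonal_mul]
    exact mul_nonneg (inv_nonneg.2 (hpos i).le) (h0 i j)
  · simp only [diagonal_mul, ← mul_sum]
    exact inv_mul_cancel₀ (hpos i).ne'

lemma adj_pow_nonneg (n : ℕ) (i j : V) : 0 ≤ (adj G ^ n) i j := by
  induction n generalizing i j with
  | zero => rw [pow_zero, one_apply]; split_ifs <;> norm_num
  | succ n ih =>
    rw [pow_succ, mul_apply]
    exact sum_nonneg fun k _ => mul_nonneg (ih i k) (adj_nonneg G k j)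

lemma adj_pow_self_pos (n : ℕ) (i : V) : 0 < (adj G ^ n) i i := by
  induction n with
  | zero => simp
  | succ n ih =>
    rw [pow_succ, mul_apply]
    refine sum_pos' (fun k _ => mul_nonneg (adj_pow_nonneg G n i k) (adj_nonneg G k i))
      ⟨i, mem_univ i, ?_⟩
    rw [adj_self, mul_one]
    exact ih

/-- Both forms of the jump matrix are stochastic, and dominate a multiple of the simple
random walk. -/
lemma levy_spec {pd : ℝ} (h0 : 0 < pd) (h1 : pd ≤ 1) {r : ℕ} (hr : 1 ≤ r) {PL : Matrix V V ℝ}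
    (hPL : PL = levyClosed G pd r ∨ PL = levyWalk G pd r) :
    PL ∈ rowStochastic ℝ V ∧
      ∀ i j, truncGeom pd r 1 * ((deg G i)⁻¹ * adj G i j) ≤ PL i j := by
  have hw : ∀ i ∈ Icc 1 r, 0 ≤ truncGeom pd r i := fun i _ => truncGeom_nonneg h0 h1 r i
  have hs := sum_truncGeom h0 h1 hr
  have h1r : 1 ∈ Icc 1 r := by simp [hr]
  rcases hPL with rfl | rfl
  · have hM : ∀ i ∈ Icc 1 r,
        Matrix.diagonal (fun v => (∑ u, (adj G ^ i) v u)⁻¹) * adj G ^ i ∈ rowStochastic ℝ V :=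
      fun i _ => normalize_mem_rowStochastic (adj_pow_nonneg G i) (adj_pow_self_pos G i)
    refine ⟨sum_smul_mem_rowStochastic hw hs hM, fun i j => ?_⟩
    have := smul_apply_le_sum hw hM h1r i j
    simpa [diagonal_mul, deg, levyClosed] using this
  · have hM : ∀ i ∈ Icc 1 r,
        (Matrix.diagonal (fun v => (deg G v)⁻¹) * adj G) ^ i ∈ rowStochastic ℝ V :=
      fun i _ => pow_mem (normalize_mem_rowStochastic (adj_nonneg G)
        (fun i => by rw [adj_self]; exact one_pos)) i
    refine ⟨sum_smul_mem_rowStochastic hw hs hM, fun i j => ?_⟩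
    have := smul_apply_le_sum hw hM h1r i j
    simpa [diagonal_mul, deg, levyWalk] using this

lemma perturbed_mem_rowStochastic {P Q : Matrix V V ℝ} (hP : P ∈ rowStochastic ℝ V)
    (hQ : Q ∈ rowStochastic ℝ V) {p : ℝ} (h0 : 0 ≤ p) (h1 : p ≤ 1) :
    perturbed p P Q ∈ rowStochastic ℝ V :=
  convex_rowStochastic hP hQ (by linarith) h0 (by ring)

/-- The chains `perturbed p (PIS G L) PL` mix uniformly fast in the jump probability `p`. -/
theorem exists_perturbed_mixing [Nonempty V] (hG : G.Connected) {L : V → ℝ} (hL : ∀ v, 0 < L v)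
    {pd : ℝ} (h0 : 0 < pd) (h1 : pd ≤ 1) {r : ℕ} (hr : 1 ≤ r) {PL : Matrix V V ℝ}
    (hPL : PL = levyClosed G pd r ∨ PL = levyWalk G pd r) :
    ∃ N : ℕ, ∀ p : ℝ, 0 ≤ p → p ≤ 1 → ∀ ν, IsStationary (perturbed p (PIS G L) PL) ν →
      ∀ v, ∑ u, |((perturbed p (PIS G L) PL) ^ N) v u - ν u| ≤ 1 / 2 := by
  obtain ⟨hPLs, hPLb⟩ := levy_spec G h0 h1 hr hPL
  -- The dummy value `1` off loops and edges lets the minimum over all pairs be a positive `c`. Both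
  -- matrices are at least `c` on loops and edges, hence so is every convex combination, whatever
  -- `p`.
  have hpos : ∀ x : V × V, 0 < (if x.1 = x.2 ∨ G.Adj x.1 x.2 then
      min (PIS G L x.1 x.2) (PL x.1 x.2) else 1) := by
    rintro ⟨i, j⟩
    split_ifs with h
    · have hq : 0 < truncGeom pd r 1 * (deg G i)⁻¹ :=
        mul_pos (truncGeom_one_pos h0 h1 hr) (inv_pos.2 (deg_pos G i))
      have hb := hPLb i j
      rcases h with h | h
      · simp only at h
        subst h
        rw [adj_self, mul_one] at hb
        exact lt_min (PIS_self_pos G L i) (hq.trans_le hb)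
      · rw [adj_of_adj h, mul_one] at hb
        exact lt_min (PIS_pos_of_adj hL h) (hq.trans_le hb)
    · exact one_pos
  obtain ⟨x₀, hx₀⟩ := Finite.exists_min (fun x : V × V => if x.1 = x.2 ∨ G.Adj x.1 x.2 then
      min (PIS G L x.1 x.2) (PL x.1 x.2) else 1)
  set c := if x₀.1 = x₀.2 ∨ G.Adj x₀.1 x₀.2 then
      min (PIS G L x₀.1 x₀.2) (PL x₀.1 x₀.2) else 1 with hc
  obtain ⟨N, hN⟩ := exists_uniform_mixing hG (hpos x₀)
  refine ⟨N, fun p hp0 hp1 ν hν v => ?_⟩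
  have hlow : ∀ i j, (i = j ∨ G.Adj i j) → c ≤ perturbed p (PIS G L) PL i j := by
    intro i j hij
    have h := hx₀ (i, j)
    simp only [hij, if_true] at h
    have h1 := h.trans (min_le_left _ _)
    have h2 := h.trans (min_le_right _ _)
    simp only [perturbed, Matrix.add_apply, Matrix.smul_apply, smul_eq_mul]
    nlinarith
  exact hN _ (perturbed_mem_rowStochastic (PIS_mem_rowStochastic G hL) hPLs hp0 hp1)
    (fun i => hlow i i (Or.inl rfl)) (fun i j h => hlow i j (Or.inr h)) ν hν v

/-- A mixing time of the unperturbed chain. -/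
theorem exists_PIS_mixing [Nonempty V] (hG : G.Connected) {L : V → ℝ} (hL : ∀ v, 0 < L v) :
    ∃ N : ℕ, ∀ v, ∑ u, |((PIS G L) ^ N) v u - L u / ∑ w, L w| ≤ 1 / 2 := by
  obtain ⟨N, hN⟩ := exists_perturbed_mixing G hG hL one_pos le_rfl le_rfl (Or.inl rfl)
  refine ⟨N, fun v => ?_⟩
  have := hN 0 le_rfl zero_le_one (fun v => L v / ∑ u, L u)
  simp only [perturbed, sub_zero, one_smul, zero_smul, add_zero] at this
  exact this (isStationary_PIS G hL) v

end Transition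

/-! ### Markov property from finite-dimensional distributions -/

section Chain

variable {V : Type*} {Ω : Type*} [MeasurableSpace Ω]

/-- A functional on sequences that depends on the entries up to time `t` only. -/
def DependsUpTo {β : Type*} (t : ℕ) (F : (ℕ → V) → β) : Prop :=
  ∀ a b : ℕ → V, (∀ i ≤ t, a i = b i) → F a = F b

/-- Functionals of finitely many states take finitely many values, so their expectations are finite
sums, and no measurability in the model variable is needed. -/
lemma integral_comp_finite {α : Type*} [Fintype α] {ℙ : Measure Ω} [IsProbabilityMeasure ℙ]
    {Y : Ω → α} (hY : ∀ a, MeasurableSet (Y ⁻¹' {a})) (F : α → ℝ) :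
    Integrable (fun ω => F (Y ω)) ℙ ∧ ∫ ω, F (Y ω) ∂ℙ = ∑ a, ℙ.real (Y ⁻¹' {a}) * F a := by
  classical
  have h : (fun ω => F (Y ω)) = fun ω => ∑ a, (Y ⁻¹' {a}).indicator (fun _ => F a) ω := by
    ext ω
    simp [Set.indicator_apply]
  have hi : ∀ a ∈ (univ : Finset α), Integrable ((Y ⁻¹' {a}).indicator (fun _ => F a)) ℙ :=
    fun a _ => (integrable_const _).indicator (hY a)
  rw [h]
  refine ⟨integrable_finsetSum _ hi, ?_⟩
  rw [integral_finsetSum _ hi]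
  exact sum_congr rfl fun a _ => by rw [integral_indicator_const _ (hY a), smul_eq_mul]

/-- Extend a finite word by a constant tail. -/
def extendWord {t : ℕ} (q : Fin (t + 1) → V) (b : V) : ℕ → V :=
  fun i => if h : i < t + 1 then q ⟨i, h⟩ else b

lemma extendWord_of_le {t : ℕ} (q : Fin (t + 1) → V) (b : V) {i : ℕ} (h : i ≤ t) :
    extendWord q b i = q ⟨i, Nat.lt_succ_of_le h⟩ := by
  rw [extendWord, dif_pos]

variable {ℙ : Measure Ω} {P : Matrix V V ℝ} {X : ℕ → Ω → V}

lemma IsMarkovChain.measurableSet_word (hX : IsMarkovChain ℙ P X) (t : ℕ) (q : Fin (t + 1) → V) :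
    MeasurableSet ((fun ω => fun i : Fin (t + 1) => X i ω) ⁻¹' {q}) := by
  have : ((fun ω => fun i : Fin (t + 1) => X i ω) ⁻¹' {q}) =
      ⋂ i : Fin (t + 1), {ω | X i ω = q i} := by
    ext ω
    simp [funext_iff]
  rw [this]
  exact MeasurableSet.iInter fun i => hX.measurable _ _

variable [IsProbabilityMeasure ℙ] [Fintype V]

lemma IsMarkovChain.integrable (hX : IsMarkovChain ℙ P X) {t : ℕ} {F : (ℕ → V) → ℝ}
    (hF : DependsUpTo t F) : Integrable (fun ω => F (fun i => X i ω)) ℙ := by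
  have h := (integral_comp_finite (ℙ := ℙ) (hX.measurableSet_word t)
    (fun q => F (extendWord q (q 0)))).1
  convert h using 2 with ω
  refine hF _ _ fun i hi => ?_
  rw [extendWord_of_le _ _ hi]

/-- The Markov property for functionals of the past and the next state. -/
lemma IsMarkovChain.integral_step (hX : IsMarkovChain ℙ P X) {t : ℕ} {F : (ℕ → V) → V → ℝ}
    (hF : DependsUpTo t F) :
    ∫ ω, F (fun i => X i ω) (X (t + 1) ω) ∂ℙ =
      ∫ ω, ∑ b, P (X t ω) b * F (fun i => X i ω) b ∂ℙ := by
  have hm : ∀ x : (Fin (t + 1) → V) × V,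
      MeasurableSet ((fun ω => ((fun i : Fin (t + 1) => X i ω), X (t + 1) ω)) ⁻¹' {x}) := by
    rintro ⟨q, b⟩
    have : ((fun ω => ((fun i : Fin (t + 1) => X i ω), X (t + 1) ω)) ⁻¹' {(q, b)}) =
        ((fun ω => fun i : Fin (t + 1) => X i ω) ⁻¹' {q}) ∩ {ω | X (t + 1) ω = b} := by
      ext ω; simp
    rw [this]
    exact (hX.measurableSet_word t q).inter (hX.measurable _ _)
  have h1 := (integral_comp_finite (ℙ := ℙ) hm
    (fun x => F (extendWord x.1 (x.1 0)) x.2)).2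
  have h2 := (integral_comp_finite (ℙ := ℙ) (hX.measurableSet_word t)
    (fun q => ∑ b, P (q (Fin.last t)) b * F (extendWord q (q 0)) b)).2
  have hE : ∀ ω, F (fun i => X i ω) =
      F (extendWord (fun i : Fin (t + 1) => X i ω) (X (0 : Fin (t + 1)) ω)) := by
    intro ω
    refine hF _ _ fun i hi => ?_
    rw [extendWord_of_le _ _ hi]
  simp only [← hE] at h1 h2
  rw [h1]
  simp only [Fin.val_last] at h2
  rw [h2, Fintype.sum_prod_type]
  refine sum_congr rfl fun q _ => ?_
  rw [mul_sum]
  refine sum_congr rfl fun b _ => ?_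
  rw [← mul_assoc]
  congr 1
  have e1 : ((fun ω => ((fun i : Fin (t + 1) => X i ω), X (t + 1) ω)) ⁻¹' {(q, b)}) =
      {ω | ∀ i ≤ t + 1, X i ω = extendWord q b i} := by
    ext ω
    simp only [Set.mem_preimage, Set.mem_singleton_iff, Prod.mk.injEq, funext_iff,
      Set.mem_ofPred_eq]
    constructor
    · rintro ⟨h, h'⟩ i hi
      rcases Nat.lt_or_ge i (t + 1) with hlt | hge
      · rw [extendWord_of_le _ _ (Nat.le_of_lt_succ hlt), ← h]
      · obtain rfl : i = t + 1 := le_antisymm hi hge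
        simp [extendWord, h']
    · intro h
      refine ⟨fun i => ?_, ?_⟩
      · rw [h i (by omega), extendWord_of_le _ _ (by omega)]
      · rw [h (t + 1) le_rfl]; simp [extendWord]
  have e2 : ((fun ω => fun i : Fin (t + 1) => X i ω) ⁻¹' {q}) =
      {ω | ∀ i ≤ t, X i ω = extendWord q b i} := by
    ext ω
    simp only [Set.mem_preimage, Set.mem_singleton_iff, funext_iff, Set.mem_ofPred_eq]
    constructor
    · intro h i hi
      rw [extendWord_of_le _ _ hi, ← h]
    · intro h i
      rw [h i (by omega), extendWord_of_le _ _ (by omega)]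
  rw [e1, e2, hX.law, hX.law, prod_range_succ, extendWord_of_le q b le_rfl, ← mul_assoc]
  simp [extendWord, Fin.last]

variable [DecidableEq V]

/-- The Markov property for functionals of the past and the state `s` steps later. -/
lemma IsMarkovChain.integral_steps (hX : IsMarkovChain ℙ P X) {t : ℕ} (s : ℕ)
    {F : (ℕ → V) → V → ℝ} (hF : DependsUpTo t F) :
    ∫ ω, F (fun i => X i ω) (X (t + s) ω) ∂ℙ =
      ∫ ω, ∑ b, (P ^ s) (X t ω) b * F (fun i => X i ω) b ∂ℙ := by
  induction s generalizing F with
  | zero => simp [one_apply]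
  | succ s ih =>
    rw [← add_assoc, hX.integral_step (t := t + s) fun a b h => hF a b fun i hi => h i (by omega)]
    -- The last transition is averaged out into the functional before the induction hypothesis is
    -- applied.
    rw [ih (F := fun a c => ∑ b, P c b * F a b) fun a b h => by
      ext c; simp only [hF a b h]]
    congr 1
    ext ω
    simp only [pow_succ, mul_apply, mul_sum, sum_mul, mul_assoc]
    exact sum_comm

end Chain

/-! ### Gradients of smooth strongly convex functions -/

section Gradient

variable {E : Type*} [NormedAddCommGroup E] [InnerProductSpace ℝ E] [CompleteSpace E]

/-- The gradient of a strongly convex function is strongly monotone. -/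
lemma StrongConvexOn.inner_gradient_sub_ge {m : ℝ} {f : E → ℝ}
    (hf : StrongConvexOn Set.univ m f) (hd : Differentiable ℝ f) (x y : E) :
    m * ‖x - y‖ ^ 2 ≤ inner ℝ (gradient f x - gradient f y) (x - y) := by
  -- On the segment from `y` to `x`, the convex function `f - (m/2)‖·‖²` has monotone derivative;
  -- its values at `0` and `1` are compared.
  have hc := (strongConvexOn_iff_convex.1 hf).comp_affineMap (AffineMap.lineMap (k := ℝ) y x)
  set φ : ℝ → ℝ := (fun x => f x - m / 2 * ‖x‖ ^ 2) ∘ (AffineMap.lineMap (k := ℝ) y x) with hφ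
  have hder : ∀ t : ℝ, HasDerivAt φ
      (inner ℝ (gradient f (AffineMap.lineMap (k := ℝ) y x t)) (x - y) -
        m * inner ℝ (AffineMap.lineMap (k := ℝ) y x t) (x - y)) t := by
    intro t
    have hl : HasDerivAt (AffineMap.lineMap (k := ℝ) y x) (x - y) t :=
      AffineMap.hasDerivAt_lineMap
    have h1 := ((hd _).hasFDerivAt (x := AffineMap.lineMap (k := ℝ) y x t)).comp_hasDerivAt t hl
    have h2 := hl.norm_sq.const_mul (m / 2)
    have h3 := h1.sub h2
    rw [inner_gradient_left]
    refine h3.congr_deriv ?_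
    ring_nf
  have hm := hc.monotoneOn_deriv (fun t _ => (hder t).differentiableAt)
  have h01 := hm (Set.mem_univ (0 : ℝ)) (Set.mem_univ (1 : ℝ)) zero_le_one
  rw [(hder 0).deriv, (hder 1).deriv, AffineMap.lineMap_apply_zero,
    AffineMap.lineMap_apply_one] at h01
  have h4 : ‖x - y‖ ^ 2 = inner ℝ x (x - y) - inner ℝ y (x - y) := by
    rw [← inner_sub_left, real_inner_self_eq_norm_sq]
  rw [inner_sub_left, h4]
  linarith

/-- Strong monotonicity against Cauchy–Schwarz; two distinct points are needed, since in dimension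
`0` nothing ties `m` to `K`. The resulting `μ ≤ L_min` is what lets `C₁` depend on `μ` alone. -/
lemma IsSmooth.le_of_strongConvexOn {K m : ℝ} {f : E → ℝ} (hs : IsSmooth K f)
    (hf : StrongConvexOn Set.univ m f) {x y : E} (hxy : x ≠ y) : m ≤ K := by
  have h1 := StrongConvexOn.inner_gradient_sub_ge hf hs.differentiable x y
  have h2 := (real_inner_le_norm (gradient f x - gradient f y) (x - y)).trans
    (mul_le_mul_of_nonneg_right (hs.lipschitz x y) (norm_nonneg _))
  have h3 : 0 < ‖x - y‖ := norm_pos_iff.2 (sub_ne_zero.2 hxy)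
  have h4 : m * ‖x - y‖ ^ 2 ≤ K * ‖x - y‖ ^ 2 := by nlinarith
  exact le_of_mul_le_mul_right h4 (by positivity)

lemma sum_gradient_eq_zero {V : Type*} [Fintype V] [Nonempty V] {f : V → E → ℝ}
    (hd : ∀ v, Differentiable ℝ (f v)) {xs : E}
    (hmin : ∀ y, (∑ v, f v xs) / Fintype.card V ≤ (∑ v, f v y) / Fintype.card V) :
    ∑ v, gradient (f v) xs = 0 := by
  have hn : (0 : ℝ) < Fintype.card V := by exact_mod_cast Fintype.card_pos
  have hloc : IsLocalMin (fun y => ∑ v, f v y) xs :=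
    Filter.Eventually.of_forall fun y => (div_le_div_iff_of_pos_right hn).1 (hmin y)
  have h0 := hloc.fderiv_eq_zero
  rw [fderiv_fun_sum fun v _ => hd v xs] at h0
  simp only [gradient, ← map_sum, h0, map_zero]

end Gradient

/-! ### Pathwise estimates for stochastic approximation -/

section Orbit

/-- Young's inequality with weight `κ`. It converts a decrease proportional to the lagged error `‖y
- xs‖²` into one proportional to the current error. -/
lemma norm_sq_le_of_displacement {E : Type*} [NormedAddCommGroup E] {xs : E} {Λ S κ : ℝ} (hκ : 0 ≤ κ) (hκ1 : κ ≤ 1)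
    (hκΛ : (1 + κ) * (1 + κ * Λ) ^ 2 ≤ 3 / 2) {x y : E}
    (hxy : ‖x - y‖ ≤ κ * (Λ * ‖y - xs‖ + 2 * S)) :
    ‖x - xs‖ ^ 2 ≤ 3 / 2 * ‖y - xs‖ ^ 2 + 8 * κ * S ^ 2 := by
  have h := norm_add_le (x - y) (y - xs)
  rw [sub_add_sub_cancel] at h
  set u := ‖y - xs‖ with hu
  have hu0 : 0 ≤ u := norm_nonneg _
  have h1 : ‖x - xs‖ ≤ (1 + κ * Λ) * u + 2 * κ * S := by linarith
  have h2 : ‖x - xs‖ ^ 2 ≤ ((1 + κ * Λ) * u + 2 * κ * S) ^ 2 :=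
    pow_le_pow_left₀ (norm_nonneg _) h1 2
  have h3 := mul_nonneg hκ (sq_nonneg ((1 + κ * Λ) * u - 2 * S))
  have h4 := mul_le_mul_of_nonneg_right hκΛ (sq_nonneg u)
  have h5 : κ ^ 2 * S ^ 2 ≤ κ * S ^ 2 :=
    mul_le_mul_of_nonneg_right (by nlinarith) (sq_nonneg S)
  nlinarith

variable {V E : Type*} [NormedAddCommGroup E] [InnerProductSpace ℝ E]

/-- Stochastic approximation with the vector fields `g v` along the sequence `v`. -/
def orbit (γ : ℝ) (g : V → E → E) (x₀ : E) (v : ℕ → V) : ℕ → E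
  | 0 => x₀
  | t + 1 => orbit γ g x₀ v t - γ • g (v t) (orbit γ g x₀ v t)

lemma iterate_eq_orbit [CompleteSpace E] [Fintype V] (γ : ℝ) (L : V → ℝ) (f : V → E → ℝ) (x₀ : E)
    (v : ℕ → V) (t : ℕ) :
    iterate γ L f x₀ v t = orbit γ (fun v x => (meanL L / L v) • gradient (f v) x) x₀ v t := by
  induction t with
  | zero => rfl
  | succ t ih => simp only [iterate, orbit, ih, mul_smul]

lemma orbit_congr (γ : ℝ) (g : V → E → E) (x₀ : E) {a b : ℕ → V} (t : ℕ)
    (h : ∀ i < t, a i = b i) : orbit γ g x₀ a t = orbit γ g x₀ b t := by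
  induction t with
  | zero => rfl
  | succ t ih =>
    simp only [orbit]
    rw [ih fun i hi => h i (by omega), h t (by omega)]

/-- Strongly monotone and Lipschitz vector fields that are bounded by `S` at the target `xs`. -/
structure IsMonotoneField (α Λ S : ℝ) (xs : E) (g : V → E → E) : Prop where
  mono : ∀ v x y, α * ‖x - y‖ ^ 2 ≤ inner ℝ (g v x - g v y) (x - y)
  lipschitz : ∀ v x y, ‖g v x - g v y‖ ≤ Λ * ‖x - y‖
  bound : ∀ v, ‖g v xs‖ ≤ S

variable {α Λ S γ : ℝ} {xs x₀ : E} {g : V → E → E}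

lemma IsMonotoneField.norm_le (hg : IsMonotoneField α Λ S xs g) (v : V) (x : E) :
    ‖g v x‖ ≤ Λ * ‖x - xs‖ + S := by
  have h := norm_add_le (g v x - g v xs) (g v xs)
  rw [sub_add_cancel] at h
  linarith [hg.lipschitz v x xs, hg.bound v]

/-- Without the offset `g v xs`, the squared factor is `1 - 2γα + γ²Λ² ≤ 1 - γα ≤ (1 - γα/2)²`. This
holds for each `v` separately, with no averaging. -/
lemma IsMonotoneField.norm_step_le (hg : IsMonotoneField α Λ S xs g) (hγ : 0 ≤ γ)
    (hγΛ : γ * Λ ^ 2 ≤ α) (hγα : γ * α ≤ 1) (v : V) (x : E) :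
    ‖x - γ • g v x - xs‖ ≤ (1 - γ * α / 2) * ‖x - xs‖ + γ * S := by
  have h1 : x - γ • g v x - xs = ((x - xs) - γ • (g v x - g v xs)) - γ • g v xs := by
    rw [smul_sub]; abel
  have h2 : ‖(x - xs) - γ • (g v x - g v xs)‖ ≤ (1 - γ * α / 2) * ‖x - xs‖ := by
    refine abs_le_of_sq_le_sq' ?_ (by have := norm_nonneg (x - xs); nlinarith) |>.2
    rw [norm_sub_sq_real, inner_smul_right, norm_smul, real_inner_comm, Real.norm_eq_abs,
      abs_of_nonneg hγ]
    have hm := mul_le_mul_of_nonneg_left (hg.mono v x xs) hγ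
    have hl : ‖g v x - g v xs‖ ^ 2 ≤ (Λ * ‖x - xs‖) ^ 2 :=
      pow_le_pow_left₀ (norm_nonneg _) (hg.lipschitz v x xs) 2
    have hl2 := mul_le_mul_of_nonneg_left hl (sq_nonneg γ)
    have hq := mul_le_mul_of_nonneg_left hγΛ (mul_nonneg hγ (sq_nonneg ‖x - xs‖))
    nlinarith [sq_nonneg (γ * α * ‖x - xs‖)]
  rw [h1]
  refine (norm_sub_le _ _).trans (add_le_add h2 ?_)
  rw [norm_smul, Real.norm_eq_abs, abs_of_nonneg hγ]
  exact mul_le_mul_of_nonneg_left (hg.bound v) hγ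

lemma IsMonotoneField.norm_orbit_add_le (hg : IsMonotoneField α Λ S xs g) (hα : 0 ≤ α)
    (hγ : 0 ≤ γ) (hγΛ : γ * Λ ^ 2 ≤ α) (hγα : γ * α ≤ 1) (v : ℕ → V) (t k : ℕ) :
    ‖orbit γ g x₀ v (t + k) - xs‖ ≤ ‖orbit γ g x₀ v t - xs‖ + k * γ * S := by
  induction k with
  | zero => simp
  | succ k ih =>
    have h := hg.norm_step_le hγ hγΛ hγα (v (t + k)) (orbit γ g x₀ v (t + k))
    have h2 : 0 ≤ γ * α / 2 * ‖orbit γ g x₀ v (t + k) - xs‖ := by positivity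
    rw [← add_assoc]
    simp only [orbit]
    push_cast
    linarith

/-- `2S/α` is the fixed point of the affine one-step bound. -/
lemma IsMonotoneField.norm_orbit_le (hg : IsMonotoneField α Λ S xs g) (hα : 0 < α)
    (hγ : 0 ≤ γ) (hγΛ : γ * Λ ^ 2 ≤ α) (hγα : γ * α ≤ 1) (v : ℕ → V) (t : ℕ) :
    ‖orbit γ g x₀ v t - xs‖ ≤ (1 - γ * α / 2) ^ t * ‖x₀ - xs‖ + 2 * S / α := by
  induction t with
  | zero =>
    have : ∀ _ : V, 0 ≤ S := fun w => (norm_nonneg _).trans (hg.bound w)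
    have := this (v 0)
    simp only [orbit, pow_zero, one_mul]
    have : 0 ≤ 2 * S / α := by positivity
    linarith
  | succ t ih =>
    have h := hg.norm_step_le hγ hγΛ hγα (v t) (orbit γ g x₀ v t)
    have h1 : 0 ≤ 1 - γ * α / 2 := by linarith
    have h2 := mul_le_mul_of_nonneg_left ih h1
    have h3 : (1 - γ * α / 2) * (2 * S / α) + γ * S = 2 * S / α := by field_simp; ring
    simp only [orbit]
    rw [pow_succ']
    linarith

/-- The displacement in a window of total length `κ = s γ`. -/
lemma IsMonotoneField.norm_orbit_sub_orbit_le (hg : IsMonotoneField α Λ S xs g) (hα : 0 ≤ α)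
    (hΛ : 0 ≤ Λ) (hγ : 0 ≤ γ) (hγΛ : γ * Λ ^ 2 ≤ α) (hγα : γ * α ≤ 1) (v : ℕ → V) (t s : ℕ)
    (hs : s * γ * Λ ≤ 1) {k : ℕ} (hk : k ≤ s) :
    ‖orbit γ g x₀ v (t + k) - orbit γ g x₀ v t‖ ≤
      k * γ * (Λ * ‖orbit γ g x₀ v t - xs‖ + 2 * S) := by
  have hS : 0 ≤ S := (norm_nonneg _).trans (hg.bound (v 0))
  induction k with
  | zero => simp
  | succ k ih =>
    have h1 := hg.norm_orbit_add_le (x₀ := x₀) hα hγ hγΛ hγα v t k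
    have h2 := hg.norm_le (v (t + k)) (orbit γ g x₀ v (t + k))
    have h3 : (k : ℝ) * γ * Λ ≤ 1 := by
      refine le_trans ?_ hs
      have : (k : ℝ) ≤ s := by exact_mod_cast (by omega : k ≤ s)
      gcongr
    have h4 := mul_le_mul_of_nonneg_left h1 hΛ
    have h5 := mul_le_mul_of_nonneg_right h3 hS
    -- Drift of the norm inside the window costs `Λ k γ S ≤ S`, hence `2S` in place of `S`.
    have h6 : ‖g (v (t + k)) (orbit γ g x₀ v (t + k))‖ ≤
        Λ * ‖orbit γ g x₀ v t - xs‖ + 2 * S := by nlinarith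
    have h7 : orbit γ g x₀ v (t + (k + 1)) - orbit γ g x₀ v t =
        (orbit γ g x₀ v (t + k) - orbit γ g x₀ v t) -
          γ • g (v (t + k)) (orbit γ g x₀ v (t + k)) := by
      rw [← add_assoc]; simp only [orbit]; abel
    rw [h7]
    refine (norm_sub_le _ _).trans ?_
    rw [norm_smul, Real.norm_eq_abs, abs_of_nonneg hγ]
    have h8 := mul_le_mul_of_nonneg_left h6 hγ
    have := ih (by omega)
    push_cast
    linarith

/-- One step from `x`, compared with the field at a point `y` visited before. -/
lemma IsMonotoneField.norm_sq_step_le (hg : IsMonotoneField α Λ S xs g) (hΛ : 0 ≤ Λ)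
    (hS : 0 ≤ S) {κ : ℝ} (hγ : 0 ≤ γ) (hγκ : γ ≤ κ) (hκΛ : κ * Λ ≤ 1) (v : V) {x y : E}
    (hxy : ‖x - y‖ ≤ κ * (Λ * ‖y - xs‖ + 2 * S)) :
    ‖x - γ • g v x - xs‖ ^ 2 ≤ ‖x - xs‖ ^ 2 - 2 * γ * inner ℝ (g v y) (y - xs) +
      γ * κ * (20 * Λ ^ 2 * ‖y - xs‖ ^ 2 + 66 * S ^ 2) := by
  have hκ : 0 ≤ κ := hγ.trans hγκ
  set u := ‖y - xs‖ with hu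
  set w := ‖x - y‖ with hw
  have hu0 : 0 ≤ u := norm_nonneg _
  have hw0 : 0 ≤ w := norm_nonneg _
  have hxu : ‖x - xs‖ ≤ u + w := by
    have := norm_add_le (x - y) (y - xs)
    rw [sub_add_sub_cancel] at this
    linarith
  have hΛw : Λ * w ≤ Λ * u + 2 * S := by
    have h1 := mul_le_mul_of_nonneg_left hxy hΛ
    have h2 : 0 ≤ Λ * u + 2 * S := by positivity
    have h3 := mul_le_mul_of_nonneg_right hκΛ h2
    nlinarith
  have hgx : ‖g v x‖ ≤ 2 * Λ * u + 3 * S := by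
    have := hg.norm_le v x
    have := mul_le_mul_of_nonneg_left hxu hΛ
    nlinarith
  have hexp : ‖x - γ • g v x - xs‖ ^ 2 =
      ‖x - xs‖ ^ 2 - 2 * γ * inner ℝ (g v x) (x - xs) + γ ^ 2 * ‖g v x‖ ^ 2 := by
    rw [sub_right_comm, norm_sub_sq_real, inner_smul_right, real_inner_comm, norm_smul,
      Real.norm_eq_abs, abs_of_nonneg hγ]
    ring
  -- The price of evaluating field and displacement at the lagged point `y`; it is of order `κ`.
  have hdiff : inner ℝ (g v y) (y - xs) - inner ℝ (g v x) (x - xs) ≤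
      κ * (3 * (Λ * u + 2 * S) ^ 2) := by
    have h1 : inner ℝ (g v y) (y - xs) - inner ℝ (g v x) (x - xs) =
        -(inner ℝ (g v x - g v y) (y - xs)) - inner ℝ (g v x) (x - y) := by
      rw [← sub_add_sub_cancel x y xs, inner_add_right, inner_sub_left]
      ring
    have h2 : -(inner ℝ (g v x - g v y) (y - xs)) ≤ Λ * w * u :=
      (neg_le_abs _).trans ((abs_real_inner_le_norm _ _).trans
        (mul_le_mul_of_nonneg_right (hg.lipschitz v x y) hu0))
    have h3 : -(inner ℝ (g v x) (x - y)) ≤ (2 * Λ * u + 3 * S) * w :=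
      (neg_le_abs _).trans ((abs_real_inner_le_norm _ _).trans
        (mul_le_mul_of_nonneg_right hgx hw0))
    have h4 : w * (3 * Λ * u + 3 * S) ≤ κ * (Λ * u + 2 * S) * (3 * Λ * u + 3 * S) :=
      mul_le_mul_of_nonneg_right hxy (by positivity)
    have h5 : κ * (Λ * u + 2 * S) * (3 * Λ * u + 3 * S) ≤ κ * (3 * (Λ * u + 2 * S) ^ 2) := by
      rw [mul_assoc]
      refine mul_le_mul_of_nonneg_left ?_ hκ
      nlinarith [mul_nonneg (mul_nonneg hΛ hu0) hS, mul_nonneg hS hS]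
    rw [h1]
    linarith
  have hsq : ‖g v x‖ ^ 2 ≤ 8 * (Λ ^ 2 * u ^ 2) + 18 * S ^ 2 := by
    have h1 : ‖g v x‖ ^ 2 ≤ (2 * Λ * u + 3 * S) ^ 2 :=
      pow_le_pow_left₀ (norm_nonneg _) hgx 2
    nlinarith [sq_nonneg (2 * Λ * u - 3 * S)]
  have hsq2 : 3 * (Λ * u + 2 * S) ^ 2 ≤ 6 * (Λ ^ 2 * u ^ 2) + 24 * S ^ 2 := by
    nlinarith [sq_nonneg (Λ * u - 2 * S)]
  have e1 : γ ^ 2 * ‖g v x‖ ^ 2 ≤ γ * κ * (8 * (Λ ^ 2 * u ^ 2) + 18 * S ^ 2) := by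
    refine mul_le_mul ?_ hsq (sq_nonneg _) (by positivity)
    rw [sq]; exact mul_le_mul_of_nonneg_left hγκ hγ
  have e2 : 2 * γ * (inner ℝ (g v y) (y - xs) - inner ℝ (g v x) (x - xs)) ≤
      2 * γ * (κ * (6 * (Λ ^ 2 * u ^ 2) + 24 * S ^ 2)) :=
    mul_le_mul_of_nonneg_left
      (hdiff.trans (mul_le_mul_of_nonneg_left hsq2 hκ)) (by positivity)
  rw [hexp]
  nlinarith

/-- Averaging the field over a distribution close to `π`. -/
lemma IsMonotoneField.sum_inner_ge [Fintype V] (hg : IsMonotoneField α Λ S xs g) {μ η : ℝ}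
    {π ρ : V → ℝ} (hΛ : 0 ≤ Λ) (hS : 0 ≤ S) (hρ : ∑ b, |ρ b - π b| ≤ η) {y : E}
    (hmean : μ * ‖y - xs‖ ^ 2 ≤ ∑ b, π b * inner ℝ (g b y) (y - xs)) :
    μ * ‖y - xs‖ ^ 2 - η * (Λ * ‖y - xs‖ ^ 2 + S * ‖y - xs‖) ≤
      ∑ b, ρ b * inner ℝ (g b y) (y - xs) := by
  have hb : ∀ b, |inner ℝ (g b y) (y - xs)| ≤ Λ * ‖y - xs‖ ^ 2 + S * ‖y - xs‖ := by
    intro b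
    have h1 := mul_le_mul_of_nonneg_right (hg.norm_le b y) (norm_nonneg (y - xs))
    have h2 := abs_real_inner_le_norm (g b y) (y - xs)
    nlinarith
  have h1 : ∑ b, π b * inner ℝ (g b y) (y - xs) - ∑ b, ρ b * inner ℝ (g b y) (y - xs) ≤
      η * (Λ * ‖y - xs‖ ^ 2 + S * ‖y - xs‖) := by
    rw [← sum_sub_distrib]
    calc ∑ b, (π b * inner ℝ (g b y) (y - xs) - ρ b * inner ℝ (g b y) (y - xs))
        ≤ ∑ b, |ρ b - π b| * (Λ * ‖y - xs‖ ^ 2 + S * ‖y - xs‖) := by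
          refine sum_le_sum fun b _ => ?_
          rw [← sub_mul]
          refine (le_abs_self _).trans ?_
          rw [abs_mul, abs_sub_comm]
          exact mul_le_mul_of_nonneg_left (hb b) (abs_nonneg _)
      _ ≤ _ := by
          rw [← sum_mul]
          exact mul_le_mul_of_nonneg_right hρ (by positivity)
  linarith

end Orbit

/-! ### Drift inequality and its solution -/

section Recursion

variable {V : Type*} [Fintype V] {Ω : Type*} [MeasurableSpace Ω]
  {E : Type*} [NormedAddCommGroup E] [InnerProductSpace ℝ E]
  {ℙ : Measure Ω} [IsProbabilityMeasure ℙ] {P : Matrix V V ℝ} {X : ℕ → Ω → V}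
  {α Λ S γ μ η : ℝ} {xs x₀ : E} {g : V → E → E} {π : V → ℝ} {s : ℕ}

lemma IsMarkovChain.integrable_norm_sq_orbit (hX : IsMarkovChain ℙ P X) (γ : ℝ) (g : V → E → E)
    (x₀ xs : E) (t : ℕ) :
    Integrable (fun ω => ‖orbit γ g x₀ (fun i => X i ω) t - xs‖ ^ 2) ℙ :=
  hX.integrable (t := t) (F := fun a => ‖orbit γ g x₀ a t - xs‖ ^ 2) fun a b h => by
    simp only [orbit_congr γ g x₀ (a := a) (b := b) t fun i hi => h i hi.le]

variable [DecidableEq V]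

/-- The drift inequality: one step of the stochastic approximation scheme after `s` steps of
mixing. -/
lemma IsMonotoneField.integral_step_le (hg : IsMonotoneField α Λ S xs g)
    (hX : IsMarkovChain ℙ P X) (hα : 0 ≤ α) (hΛ : 0 ≤ Λ) (hS : 0 ≤ S) (hμ : 0 < μ)
    (hγ : 0 ≤ γ) (hγΛ : γ * Λ ^ 2 ≤ α) (hγα : γ * α ≤ 1) (hs : 1 ≤ s)
    (hκ1 : s * γ ≤ 1) (hκΛ : s * γ * Λ ≤ 1)
    (hκ2 : (1 + s * γ) * (1 + s * γ * Λ) ^ 2 ≤ 3 / 2)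
    (hκ3 : 10 * (s * γ) * Λ ^ 2 ≤ μ / 16) (hη : η * Λ ≤ μ / 16)
    (hmix : ∀ v, ∑ b, |(P ^ s) v b - π b| ≤ η)
    (hmean : ∀ y, μ * ‖y - xs‖ ^ 2 ≤ ∑ b, π b * inner ℝ (g b y) (y - xs)) (t : ℕ) :
    ∫ ω, ‖orbit γ g x₀ (fun i => X i ω) (t + s + 1) - xs‖ ^ 2 ∂ℙ ≤
      (1 - γ * μ) * ∫ ω, ‖orbit γ g x₀ (fun i => X i ω) (t + s) - xs‖ ^ 2 ∂ℙ +
        γ * ((66 + 8 * μ) * (s * γ) * S ^ 2 + 4 * η ^ 2 * S ^ 2 / μ) := by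
  set κ : ℝ := s * γ with hκd
  have hκ0 : 0 ≤ κ := by positivity
  have hγκ : γ ≤ κ := by
    have : (1 : ℝ) ≤ s := by exact_mod_cast hs
    nlinarith
  set u : Ω → ℝ := fun ω => ‖orbit γ g x₀ (fun i => X i ω) t - xs‖ with hu
  set z : ℕ → Ω → ℝ := fun n ω => ‖orbit γ g x₀ (fun i => X i ω) n - xs‖ ^ 2 with hz
  set F : (ℕ → V) → V → ℝ := fun a b =>
    inner ℝ (g b (orbit γ g x₀ a t)) (orbit γ g x₀ a t - xs) with hF
  have hcongr : ∀ n (a b : ℕ → V), (∀ i ≤ n, a i = b i) →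
      orbit γ g x₀ a n = orbit γ g x₀ b n := fun n a b h =>
    orbit_congr γ g x₀ n fun i hi => h i hi.le
  have hFdep : DependsUpTo t F := fun a b h => by simp only [hF, hcongr t a b h]
  have hdisp : ∀ ω, ‖orbit γ g x₀ (fun i => X i ω) (t + s) - orbit γ g x₀ (fun i => X i ω) t‖ ≤
      κ * (Λ * u ω + 2 * S) := fun ω =>
    hg.norm_orbit_sub_orbit_le hα hΛ hγ hγΛ hγα _ t s hκΛ le_rfl
  have hpath : ∀ ω, z (t + s + 1) ω ≤ z (t + s) ω - 2 * γ * F (fun i => X i ω) (X (t + s) ω) +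
      γ * κ * (20 * Λ ^ 2 * u ω ^ 2 + 66 * S ^ 2) := fun ω =>
    hg.norm_sq_step_le hΛ hS hγ hγκ hκΛ (X (t + s) ω) (hdisp ω)
  have hlow : ∀ ω, z (t + s) ω ≤ 3 / 2 * u ω ^ 2 + 8 * κ * S ^ 2 := fun ω =>
    norm_sq_le_of_displacement hκ0 hκ1 hκ2 (hdisp ω)
  have hiz : ∀ n, Integrable (z n) ℙ := fun n => hX.integrable_norm_sq_orbit γ g x₀ xs n
  have hiu : Integrable (fun ω => u ω ^ 2) ℙ := hiz t
  have hiF : Integrable (fun ω => F (fun i => X i ω) (X (t + s) ω)) ℙ :=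
    hX.integrable (t := t + s) (F := fun a => F a (a (t + s))) fun a b h => by
      simp only [hFdep a b fun i hi => h i (by omega), h (t + s) le_rfl]
  have hiG : Integrable (fun ω => ∑ b, (P ^ s) (X t ω) b * F (fun i => X i ω) b) ℙ :=
    hX.integrable (t := t) (F := fun a => ∑ b, (P ^ s) (a t) b * F a b) fun a b h => by
      simp only [hFdep a b h, h t le_rfl]
  have hdrift : ∀ ω, z (t + s) ω - 2 * γ * (∑ b, (P ^ s) (X t ω) b * F (fun i => X i ω) b) +
      γ * κ * (20 * Λ ^ 2 * u ω ^ 2 + 66 * S ^ 2) ≤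
      (1 - γ * μ) * z (t + s) ω + γ * ((66 + 8 * μ) * κ * S ^ 2 + 4 * η ^ 2 * S ^ 2 / μ) := by
    intro ω
    have h1 := hg.sum_inner_ge hΛ hS (hmix (X t ω)) (hmean (orbit γ g x₀ (fun i => X i ω) t))
    -- Young's inequality absorbs the part linear in `u` and leaves `η²`; this is the source of the
    -- square on `p_J`.
    have h2 : η * S * u ω ≤ μ / 8 * u ω ^ 2 + 2 * η ^ 2 * S ^ 2 / μ := by
      have : 0 ≤ (μ / 4 * u ω - η * S) ^ 2 / (μ / 2) := by positivity
      have e : (μ / 4 * u ω - η * S) ^ 2 / (μ / 2) =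
        μ / 8 * u ω ^ 2 + 2 * η ^ 2 * S ^ 2 / μ - η * S * u ω := by field_simp; ring
      linarith
    have h3 := mul_le_mul_of_nonneg_right hη (sq_nonneg (u ω))
    have h4 := mul_le_mul_of_nonneg_right hκ3 (sq_nonneg (u ω))
    have h5 := mul_le_mul_of_nonneg_left (hlow ω) hμ.le
    -- The coefficients of `u²` add up to `-2μ + μ/8 + μ/4 + μ/8 = -3μ/2`, which matches the `3/2`
    -- in `hlow` and yields exactly `-μ z`.
    have h6 : -2 * (∑ b, (P ^ s) (X t ω) b * F (fun i => X i ω) b) +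
        κ * (20 * Λ ^ 2 * u ω ^ 2 + 66 * S ^ 2) ≤
        -μ * z (t + s) ω + ((66 + 8 * μ) * κ * S ^ 2 + 4 * η ^ 2 * S ^ 2 / μ) := by
      have e : 4 * η ^ 2 * S ^ 2 / μ = 2 * (2 * η ^ 2 * S ^ 2 / μ) := by ring
      rw [e]
      simp only [hF]
      change μ * u ω ^ 2 - η * (Λ * u ω ^ 2 + S * u ω) ≤ _ at h1
      linarith
    have h7 := mul_le_mul_of_nonneg_left h6 hγ
    linarith
  have hsplit : ∀ {H : Ω → ℝ}, Integrable H ℙ →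
      ∫ ω, (z (t + s) ω - 2 * γ * H ω + γ * κ * (20 * Λ ^ 2 * u ω ^ 2 + 66 * S ^ 2)) ∂ℙ =
        ∫ ω, z (t + s) ω ∂ℙ - 2 * γ * ∫ ω, H ω ∂ℙ +
          ∫ ω, γ * κ * (20 * Λ ^ 2 * u ω ^ 2 + 66 * S ^ 2) ∂ℙ := by
    intro H hH
    rw [integral_add (f := fun ω => z (t + s) ω - 2 * γ * H ω)
      (g := fun ω => γ * κ * (20 * Λ ^ 2 * u ω ^ 2 + 66 * S ^ 2)) ((hiz _).sub (hH.const_mul _))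
      (((hiu.const_mul _).add (integrable_const _)).const_mul _),
      integral_sub (hiz _) (hH.const_mul _), integral_const_mul]
  calc ∫ ω, z (t + s + 1) ω ∂ℙ
      ≤ ∫ ω, (z (t + s) ω - 2 * γ * F (fun i => X i ω) (X (t + s) ω) +
          γ * κ * (20 * Λ ^ 2 * u ω ^ 2 + 66 * S ^ 2)) ∂ℙ := by
        refine integral_mono (hiz _) ?_ hpath
        exact ((hiz _).sub (hiF.const_mul _)).add
          (((hiu.const_mul _).add (integrable_const _)).const_mul _)
    _ = ∫ ω, (z (t + s) ω - 2 * γ * (∑ b, (P ^ s) (X t ω) b * F (fun i => X i ω) b) +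
          γ * κ * (20 * Λ ^ 2 * u ω ^ 2 + 66 * S ^ 2)) ∂ℙ := by
        rw [hsplit hiF, hsplit hiG, hX.integral_steps s hFdep]
    _ ≤ ∫ ω, ((1 - γ * μ) * z (t + s) ω +
          γ * ((66 + 8 * μ) * κ * S ^ 2 + 4 * η ^ 2 * S ^ 2 / μ)) ∂ℙ := by
        refine integral_mono ?_ (((hiz _).const_mul _).add (integrable_const _)) hdrift
        exact ((hiz _).sub (hiG.const_mul _)).add
          (((hiu.const_mul _).add (integrable_const _)).const_mul _)
    _ = _ := by
        rw [integral_add ((hiz _).const_mul _) (integrable_const _), integral_const_mul]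
        simp [hz]

lemma le_of_affine_recursion {a : ℕ → ℝ} {q b c : ℝ} (hq : 0 ≤ q) (hc : c = q * c + b)
    (h : ∀ k, a (k + 1) ≤ q * a k + b) (hc0 : 0 ≤ c) (k : ℕ) : a k ≤ q ^ k * a 0 + c := by
  induction k with
  | zero => simpa using hc0
  | succ k ih =>
    have := mul_le_mul_of_nonneg_left ih hq
    rw [pow_succ']
    linarith [h k]

/-- The mean square error after `s + k` steps. -/
theorem IsMonotoneField.integral_norm_sq_orbit_le (hg : IsMonotoneField α Λ S xs g)
    (hX : IsMarkovChain ℙ P X) (hα : 0 ≤ α) (hΛ : 0 ≤ Λ) (hS : 0 ≤ S) (hμ : 0 < μ)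
    (hγ : 0 < γ) (hγΛ : γ * Λ ^ 2 ≤ α) (hγα : γ * α ≤ 1) (hγμ : γ * μ ≤ 1) (hs : 1 ≤ s)
    (hκ1 : s * γ ≤ 1) (hκΛ : s * γ * Λ ≤ 1)
    (hκ2 : (1 + s * γ) * (1 + s * γ * Λ) ^ 2 ≤ 3 / 2)
    (hκ3 : 10 * (s * γ) * Λ ^ 2 ≤ μ / 16) (hη : η * Λ ≤ μ / 16)
    (hmix : ∀ v, ∑ b, |(P ^ s) v b - π b| ≤ η)
    (hmean : ∀ y, μ * ‖y - xs‖ ^ 2 ≤ ∑ b, π b * inner ℝ (g b y) (y - xs)) (k : ℕ) :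
    ∫ ω, ‖orbit γ g x₀ (fun i => X i ω) (s + k) - xs‖ ^ 2 ∂ℙ ≤
      (1 - γ * μ) ^ k * (‖x₀ - xs‖ + s * γ * S) ^ 2 +
        ((66 + 8 * μ) * (s * γ) * S ^ 2 + 4 * η ^ 2 * S ^ 2 / μ) / μ := by
  have hq : 0 ≤ 1 - γ * μ := by linarith
  refine (le_of_affine_recursion
    (a := fun k => ∫ ω, ‖orbit γ g x₀ (fun i => X i ω) (s + k) - xs‖ ^ 2 ∂ℙ) hq
    (b := γ * ((66 + 8 * μ) * (s * γ) * S ^ 2 + 4 * η ^ 2 * S ^ 2 / μ))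
    (c := ((66 + 8 * μ) * (s * γ) * S ^ 2 + 4 * η ^ 2 * S ^ 2 / μ) / μ) (by field_simp; ring)
    (fun k => ?_) (by positivity) k).trans (add_le_add ?_ le_rfl)
  · have := hg.integral_step_le (x₀ := x₀) hX hα hΛ hS hμ hγ.le hγΛ hγα hs hκ1 hκΛ hκ2 hκ3 hη hmix
      hmean k
    rwa [add_comm k s] at this
  · refine mul_le_mul_of_nonneg_left ?_ (pow_nonneg hq k)
    calc ∫ ω, ‖orbit γ g x₀ (fun i => X i ω) (s + 0) - xs‖ ^ 2 ∂ℙ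
        ≤ ∫ _ω, (‖x₀ - xs‖ + s * γ * S) ^ 2 ∂ℙ := by
          refine integral_mono (hX.integrable_norm_sq_orbit γ g x₀ xs _) (integrable_const _)
            fun ω => ?_
          refine pow_le_pow_left₀ (norm_nonneg _) ?_ 2
          have := hg.norm_orbit_add_le (x₀ := x₀) hα hγ.le hγΛ hγα (fun i => X i ω) 0 s
          simpa [orbit] using this
      _ = _ := by simp

end Recursion

/-! ### Importance-weighted gradients as a monotone field -/

section Field

variable {V : Type*} [Fintype V] {L : V → ℝ}

lemma minL_le (v : V) : minL L ≤ L v :=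
  ciInf_le (Set.finite_range L).bddBelow v

variable [Nonempty V]

lemma meanL_pos (hL : ∀ v, 0 < L v) : 0 < meanL L :=
  div_pos (sum_pos (fun v _ => hL v) univ_nonempty) (by exact_mod_cast Fintype.card_pos)

lemma exists_minL_eq (L : V → ℝ) : ∃ v, L v = minL L :=
  exists_eq_ciInf_of_finite

lemma minL_pos (hL : ∀ v, 0 < L v) : 0 < minL L := by
  obtain ⟨v, hv⟩ := exists_minL_eq L
  exact hv ▸ hL v

lemma minL_le_meanL (L : V → ℝ) : minL L ≤ meanL L := by
  have hn : (0 : ℝ) < Fintype.card V := by exact_mod_cast Fintype.card_pos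
  rw [meanL, le_div_iff₀ hn]
  calc minL L * Fintype.card V = ∑ _v : V, minL L := by simp [mul_comm]
    _ ≤ _ := sum_le_sum fun v _ => minL_le v

variable {E : Type*} [NormedAddCommGroup E] [InnerProductSpace ℝ E] [CompleteSpace E]
  {f : V → E → ℝ} {μ σ : ℝ} {xs : E}

/-- The importance-weighted gradients form a monotone field. -/
lemma isMonotoneField_gradient (hL : ∀ v, 0 < L v) (hμ : 0 < μ) (hσ : 0 < σ)
    (hs : ∀ v, IsSmooth (L v) (f v)) (hc : ∀ v, StrongConvexOn Set.univ μ (f v))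
    (hb : ∀ v, ‖gradient (f v) xs‖ ^ 2 ≤ σ ^ 2) :
    IsMonotoneField (μ / Fintype.card V) (meanL L) (meanL L / minL L * σ) xs
      (fun v x => (meanL L / L v) • gradient (f v) x) := by
  have hm := meanL_pos hL
  have hmin := minL_pos hL
  refine ⟨fun v x y => ?_, fun v x y => ?_, fun v => ?_⟩
  · have h1 := StrongConvexOn.inner_gradient_sub_ge (hc v) (hs v).differentiable x y
    have hLv := hL v
    -- `L v` is at most the sum `|V| L̄`; this is where the modulus `μ / |V|` comes from.
    have h2 : 1 / (Fintype.card V : ℝ) ≤ meanL L / L v := by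
      rw [meanL, div_div, mul_comm, ← div_div]
      gcongr
      rw [one_le_div hLv]
      exact single_le_sum (fun u _ => (hL u).le) (mem_univ v)
    rw [← smul_sub, real_inner_smul_left]
    calc μ / Fintype.card V * ‖x - y‖ ^ 2 = 1 / (Fintype.card V : ℝ) * (μ * ‖x - y‖ ^ 2) := by ring
      _ ≤ meanL L / L v * (μ * ‖x - y‖ ^ 2) := by gcongr
      _ ≤ _ := mul_le_mul_of_nonneg_left h1 (by positivity)
  · have hLv := hL v
    rw [← smul_sub, norm_smul, Real.norm_eq_abs, abs_of_pos (by positivity)]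
    calc _ ≤ meanL L / L v * (L v * ‖x - y‖) :=
          mul_le_mul_of_nonneg_left ((hs v).lipschitz x y) (by positivity)
      _ = _ := by field_simp
  · have hLv := hL v
    rw [norm_smul, Real.norm_eq_abs, abs_of_pos (by positivity)]
    have h1 : ‖gradient (f v) xs‖ ≤ σ := abs_le_of_sq_le_sq' (hb v) hσ.le |>.2
    have := minL_le (L := L) v
    gcongr

/-- Under the distribution proportional to `L`, the importance-weighted gradients average to the
gradient of the mean loss. -/
lemma sum_inner_gradient_ge (hL : ∀ v, 0 < L v) (hs : ∀ v, IsSmooth (L v) (f v))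
    (hc : ∀ v, StrongConvexOn Set.univ μ (f v))
    (hmin : ∀ y, (∑ v, f v xs) / Fintype.card V ≤ (∑ v, f v y) / Fintype.card V) (y : E) :
    μ * ‖y - xs‖ ^ 2 ≤
      ∑ v, L v / (∑ u, L u) * inner ℝ ((meanL L / L v) • gradient (f v) y) (y - xs) := by
  have hn : (0 : ℝ) < Fintype.card V := by exact_mod_cast Fintype.card_pos
  have hsum : 0 < ∑ u, L u := sum_pos (fun u _ => hL u) univ_nonempty
  have h1 : ∀ v, L v / (∑ u, L u) * inner ℝ ((meanL L / L v) • gradient (f v) y) (y - xs) =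
      1 / (Fintype.card V : ℝ) * inner ℝ (gradient (f v) y) (y - xs) := by
    intro v
    have := hL v
    rw [real_inner_smul_left, meanL]
    field_simp
  have h2 := sum_gradient_eq_zero (fun v => (hs v).differentiable) hmin
  have h3 : ∑ v, inner ℝ (gradient (f v) y) (y - xs) =
      ∑ v, inner ℝ (gradient (f v) y - gradient (f v) xs) (y - xs) := by
    simp only [inner_sub_left (gradient _ _), sum_sub_distrib, ← sum_inner, h2, inner_zero_left,
      sub_zero]
  simp only [h1]
  rw [← mul_sum, h3]
  calc μ * ‖y - xs‖ ^ 2 = 1 / (Fintype.card V : ℝ) * ∑ _v : V, μ * ‖y - xs‖ ^ 2 := by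
        simp only [sum_const, card_univ, nsmul_eq_mul]
        field_simp
    _ ≤ _ := by
        refine mul_le_mul_of_nonneg_left (sum_le_sum fun v _ => ?_) (by positivity)
        exact StrongConvexOn.inner_gradient_sub_ge (hc v) (hs v).differentiable y xs

end Field

/-! ### The step size for a long horizon -/

section StepSize

variable {Lb μ σ D : ℝ} {τ T N : ℕ}

/-- For a long horizon the step size is the logarithmic one. -/
lemma stepSize_spec (hLb : 0 < Lb) (hμ : 0 < μ) (hσ : 0 < σ) (hD : 0 < D) (hτ : 1 ≤ τ)
    (hτN : τ ≤ N) (hT : 1 ≤ T)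
    (h1 : 0 < Real.log (T * (D ^ 2 * μ ^ 2 / (N * σ ^ 2 * Lb))))
    (h2 : D ^ 2 * μ ^ 2 / (σ ^ 2 * Lb) ≤ T)
    (h3 : 2 * Real.log T / (T * μ) ≤ 1 / Lb) :
    0 < stepSize Lb μ σ D τ T ∧ stepSize Lb μ σ D τ T ≤ 2 * Real.log T / (T * μ) ∧
      Real.exp (-(stepSize Lb μ σ D τ T * μ * T)) = τ * σ ^ 2 * Lb / (T * (D ^ 2 * μ ^ 2)) ∧
      Real.log (T * (D ^ 2 * μ ^ 2 / (N * σ ^ 2 * Lb))) ≤ stepSize Lb μ σ D τ T * μ * T := by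
  have hT0 : (0 : ℝ) < T := by exact_mod_cast hT
  have hτ0 : (0 : ℝ) < τ := by exact_mod_cast hτ
  have hτ1 : (1 : ℝ) ≤ τ := by exact_mod_cast hτ
  have hτN' : (τ : ℝ) ≤ N := by exact_mod_cast hτN
  have hN0 : (0 : ℝ) < N := hτ0.trans_le hτN'
  set q := (T : ℝ) * (D ^ 2 * μ ^ 2 / (τ * σ ^ 2 * Lb)) with hq
  have hq0 : 0 < q := by positivity
  have hle1 : Real.log (T * (D ^ 2 * μ ^ 2 / (N * σ ^ 2 * Lb))) ≤ Real.log q := by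
    apply Real.log_le_log (by positivity)
    rw [hq]; gcongr
  -- For large `T` the problem constants in `q` are at most `T`, so `q ≤ T²` and the step is `O(log
  -- T / (T μ))` with an absolute constant.
  have hle2 : Real.log q ≤ 2 * Real.log T := by
    have : q ≤ (T : ℝ) ^ 2 := by
      rw [hq, sq (T : ℝ)]
      refine mul_le_mul_of_nonneg_left (le_trans ?_ h2) hT0.le
      gcongr
      nlinarith [show 0 < σ ^ 2 by positivity]
    calc Real.log q ≤ Real.log ((T : ℝ) ^ 2) := Real.log_le_log hq0 this
      _ = _ := by rw [Real.log_pow]; norm_num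
  have hle3 : 1 / (T * μ) * Real.log q ≤ 2 * Real.log T / (T * μ) := by
    rw [one_div_mul_eq_div]; gcongr
  have heq : stepSize Lb μ σ D τ T = 1 / (T * μ) * Real.log q :=
    min_eq_right (hle3.trans h3)
  have hmul : stepSize Lb μ σ D τ T * μ * T = Real.log q := by rw [heq]; field_simp
  refine ⟨?_, heq ▸ hle3, ?_, hmul ▸ hle1⟩
  · rw [heq]; exact mul_pos (by positivity) (h1.trans_le hle1)
  · rw [hmul, Real.exp_neg, Real.exp_log hq0, hq]
    field_simp

lemma eventually_log_ge (a : ℝ) {c : ℝ} (hc : 0 < c) :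
    ∀ᶠ T : ℕ in Filter.atTop, a ≤ Real.log (T * c) :=
  (Real.tendsto_log_atTop.comp
    (tendsto_natCast_atTop_atTop.atTop_mul_const hc)).eventually_ge_atTop a

lemma eventually_mul_log_pow_le (a : ℝ) (k : ℕ) :
    ∀ᶠ T : ℕ in Filter.atTop, a * Real.log T ^ k ≤ T := by
  have h : (fun x : ℝ => a * Real.log x ^ k) =o[Filter.atTop] id :=
    (Real.isLittleO_pow_log_id_atTop (n := k)).const_mul_left a
  have h2 := tendsto_natCast_atTop_atTop (R := ℝ) |>.eventually (h.bound one_pos)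
  filter_upwards [h2] with T hT
  have := (le_abs_self _).trans hT
  simpa using this

end StepSize

/-! ### Error bounds with and without mixing -/

section Bounds

variable {V : Type*} [Fintype V] {Ω : Type*} [MeasurableSpace Ω]
  {E : Type*} [NormedAddCommGroup E] [InnerProductSpace ℝ E]
  {ℙ : Measure Ω} [IsProbabilityMeasure ℙ] {P : Matrix V V ℝ} {X : ℕ → Ω → V}
  {α Λ S γ μ : ℝ} {xs x₀ : E} {g : V → E → E}

lemma one_sub_pow_le_exp {q : ℝ} (hq : q ≤ 1) (k : ℕ) : (1 - q) ^ k ≤ Real.exp (-(q * k)) := by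
  calc (1 - q) ^ k ≤ Real.exp (-q) ^ k :=
        pow_le_pow_left₀ (by linarith) (Real.one_sub_le_exp_neg q) k
    _ = _ := by rw [← Real.exp_nat_mul]; ring_nf

/-- A bound that uses the contraction of every single step only, and no mixing. -/
lemma IsMonotoneField.integral_norm_sq_orbit_le_of_contraction (hg : IsMonotoneField α Λ S xs g)
    (hX : IsMarkovChain ℙ P X) (hα : 0 < α) (hγ : 0 ≤ γ) (hγΛ : γ * Λ ^ 2 ≤ α)
    (hγα : γ * α ≤ 1) {T : ℕ} (hT : 2 * ‖x₀ - xs‖ ≤ γ * α * T) :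
    ∫ ω, ‖orbit γ g x₀ (fun i => X i ω) T - xs‖ ^ 2 ∂ℙ ≤ (1 + 2 * S / α) ^ 2 := by
  have h1 : (1 - γ * α / 2) ^ T * ‖x₀ - xs‖ ≤ 1 := by
    have h2 := one_sub_pow_le_exp (show γ * α / 2 ≤ 1 by linarith) T
    have h3 : Real.exp (-(γ * α / 2 * T)) ≤ Real.exp (-‖x₀ - xs‖) :=
      Real.exp_le_exp.2 (by linarith)
    calc _ ≤ Real.exp (-‖x₀ - xs‖) * Real.exp ‖x₀ - xs‖ :=
          mul_le_mul (h2.trans h3) (by linarith [Real.add_one_le_exp ‖x₀ - xs‖]) (norm_nonneg _)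
            (Real.exp_pos _).le
      _ = 1 := by rw [← Real.exp_add]; simp
  calc _ ≤ ∫ _ω, (1 + 2 * S / α) ^ 2 ∂ℙ := by
        refine integral_mono (hX.integrable_norm_sq_orbit γ g x₀ xs T) (integrable_const _)
          fun ω => pow_le_pow_left₀ (norm_nonneg _) ?_ 2
        exact (hg.norm_orbit_le hα hγ hγΛ hγα _ T).trans (by linarith)
    _ = _ := by simp

variable [DecidableEq V]

/-- `1 / ln 2 < 2`, and the extra `1` is at most `ln T`. -/
lemma natLog_add_one_le {T : ℕ} (hT : 1 ≤ Real.log T) :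
    ((Nat.log 2 T + 1 : ℕ) : ℝ) ≤ 3 * Real.log T := by
  have hT0 : T ≠ 0 := by rintro rfl; simp at hT; linarith
  have h1 : ((2 : ℝ)) ^ Nat.log 2 T ≤ T := by exact_mod_cast Nat.pow_log_le_self 2 hT0
  have h2 := Real.log_le_log (by positivity) h1
  rw [Real.log_pow] at h2
  have h3 := Real.log_two_gt_d9
  have h4 : (0 : ℝ) ≤ Nat.log 2 T := Nat.cast_nonneg _
  push_cast
  nlinarith

lemma half_pow_natLog_le {T : ℕ} (hT : 1 ≤ T) :
    (1 / 2 : ℝ) ^ (Nat.log 2 T + 1) ≤ 1 / T := by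
  have h1 : (T : ℝ) ≤ 2 ^ (Nat.log 2 T + 1) := by
    exact_mod_cast (Nat.lt_pow_succ_log_self one_lt_two T).le
  have hT0 : (0 : ℝ) < T := by exact_mod_cast hT
  rw [_root_.one_div_pow]
  exact one_div_le_one_div_of_le hT0 h1

set_option maxHeartbeats 1600000 in
/-- The mean square error when the law of the chain `m τ` steps ahead is within
`2 ⋅ 2⁻ᵐ + e` of `π`. -/
theorem IsMonotoneField.integral_norm_sq_orbit_le_log {Lm σ e D : ℝ} {π : V → ℝ} {τ T : ℕ}
    (hg : IsMonotoneField α Λ (Λ / Lm * σ) xs g) (hX : IsMarkovChain ℙ P X)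
    (hα : 0 < α) (hμ : 0 < μ) (hσ : 0 < σ) (hLm : 0 < Lm) (hLmΛ : Lm ≤ Λ) (hμLm : μ ≤ Lm)
    (hD : 0 < D) (hx₀ : ‖x₀ - xs‖ = D) (he : e * Λ ≤ μ / 32)
    (hmix : ∀ m v, ∑ b, |(P ^ (m * τ)) v b - π b| ≤ 2 * (1 / 2) ^ m + e)
    (hmean : ∀ y, μ * ‖y - xs‖ ^ 2 ≤ ∑ b, π b * inner ℝ (g b y) (y - xs))
    (hτ : 1 ≤ τ) (hlog : 1 ≤ Real.log T) (hγ : 0 < γ) (hγT : γ ≤ 2 * Real.log T / (T * μ))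
    (hexp : Real.exp (-(γ * μ * T)) = τ * σ ^ 2 * Λ / (T * (D ^ 2 * μ ^ 2)))
    (hsmall : 6 * τ * Real.log T ^ 2 / (μ * T) *
      (10 + 10 * Λ + 160 * Λ ^ 2 / μ + Λ / Lm * σ / D + μ + Λ ^ 2 / α + α) ≤ 1)
    (hsT : 3 * τ * Real.log T ≤ T) (hTΛ : 64 * Λ ≤ μ * T) :
    ∫ ω, ‖orbit γ g x₀ (fun i => X i ω) T - xs‖ ^ 2 ∂ℙ ≤
      (12 / μ ^ 2 + 6 * (66 + 8 * μ) / μ ^ 3 + 32 / μ ^ 3) * Real.log T ^ 2 *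
        (Λ ^ 2 * τ * σ ^ 2 / (Lm * T)) + 8 * (Λ / Lm * σ) ^ 2 / μ ^ 2 * e ^ 2 := by
  have hΛ : 0 < Λ := hLm.trans_le hLmΛ
  set S := Λ / Lm * σ with hS
  have hS0 : 0 < S := by positivity
  set l := Real.log T with hl
  have hT1 : 1 ≤ T := by
    rcases Nat.eq_zero_or_pos T with h | h
    · rw [hl, h] at hlog; simp at hlog; linarith
    · exact h
  have hT0 : (0 : ℝ) < T := by exact_mod_cast hT1
  have hT1' : (1 : ℝ) ≤ T := by exact_mod_cast hT1
  have hτ1 : (1 : ℝ) ≤ τ := by exact_mod_cast hτ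
  -- Enough mixing blocks for `2⁻ᵐ ≤ 1/T`, yet only logarithmically many.
  set m := Nat.log 2 T + 1 with hm
  set s := m * τ with hs
  have hm3 : (m : ℝ) ≤ 3 * l := natLog_add_one_le hlog
  have hs1 : 1 ≤ s := Nat.mul_pos (Nat.succ_pos _) hτ
  have hsle : (s : ℝ) ≤ 3 * l * τ := by
    rw [hs]; push_cast; gcongr
  have hsT' : s ≤ T := by
    have : (s : ℝ) ≤ T := by linarith
    exact_mod_cast this
  set κ : ℝ := s * γ with hκ
  have hκ0 : 0 < κ := mul_pos (by exact_mod_cast hs1) hγ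
  have hκle : κ ≤ 6 * τ * l ^ 2 / (μ * T) := by
    calc κ ≤ (3 * l * τ) * (2 * l / (T * μ)) := by rw [hκ]; gcongr
      _ = _ := by field_simp; ring
  have hγκ : γ ≤ κ := by
    have : (1 : ℝ) ≤ s := by exact_mod_cast hs1
    exact le_mul_of_one_le_left hγ.le this
  -- One smallness condition on the window length `κ`; each summand yields one of the requirements
  -- `q0`–`q6`.
  have hall : κ * (10 + 10 * Λ + 160 * Λ ^ 2 / μ + S / D + μ + Λ ^ 2 / α + α) ≤ 1 :=
    (mul_le_mul_of_nonneg_right hκle (by positivity)).trans hsmall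
  have p1 : 0 ≤ κ * (10 * Λ) := by positivity
  have p2 : 0 ≤ κ * (160 * Λ ^ 2 / μ) := by positivity
  have p3 : 0 ≤ κ * (S / D) := by positivity
  have p4 : 0 ≤ κ * μ := by positivity
  have p5 : 0 ≤ κ * (Λ ^ 2 / α) := by positivity
  have p6 : 0 ≤ κ * α := by positivity
  have q0 : κ ≤ 1 / 10 := by linarith
  have q1 : κ * Λ ≤ 1 / 10 := by linarith
  have q2 : 10 * κ * Λ ^ 2 ≤ μ / 16 := by
    have : κ * (160 * Λ ^ 2 / μ) ≤ 1 := by linarith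
    rw [← mul_div_assoc, div_le_one hμ] at this
    linarith
  have q3 : κ * S ≤ D := by
    have : κ * (S / D) ≤ 1 := by linarith
    rwa [← mul_div_assoc, div_le_one hD] at this
  have q4 : κ * μ ≤ 1 := by linarith
  have q5 : κ * Λ ^ 2 ≤ α := by
    have : κ * (Λ ^ 2 / α) ≤ 1 := by linarith
    rwa [← mul_div_assoc, div_le_one hα] at this
  have q6 : κ * α ≤ 1 := by linarith
  have q7 : (1 + κ) * (1 + κ * Λ) ^ 2 ≤ 3 / 2 := by
    calc (1 + κ) * (1 + κ * Λ) ^ 2 ≤ (1 + 1 / 10) * (1 + 1 / 10) ^ 2 := by gcongr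
      _ ≤ 3 / 2 := by norm_num
  set δ : ℝ := 2 * (1 / 2) ^ m with hδ
  have hδ0 : 0 ≤ δ := by positivity
  have hδT : δ ≤ 2 / T := by
    have := half_pow_natLog_le hT1
    rw [hδ, hm]
    calc _ ≤ 2 * (1 / (T : ℝ)) := by gcongr
      _ = _ := by ring
  have hηΛ : (δ + e) * Λ ≤ μ / 16 := by
    have : δ * Λ ≤ 2 / T * Λ := by gcongr
    have h2 : 2 / T * Λ ≤ μ / 32 := by
      rw [div_mul_eq_mul_div, div_le_iff₀ hT0]; linarith
    linarith
  have main := hg.integral_norm_sq_orbit_le (x₀ := x₀) hX hα.le hΛ.le hS0.le hμ hγ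
    ((mul_le_mul_of_nonneg_right hγκ (by positivity)).trans q5)
    ((mul_le_mul_of_nonneg_right hγκ hα.le).trans q6)
    ((mul_le_mul_of_nonneg_right hγκ hμ.le).trans q4) hs1 (by linarith) (by linarith) q7 q2
    hηΛ (hmix m) hmean (T - s)
  rw [Nat.add_sub_cancel' hsT', hx₀] at main
  refine main.trans ?_
  set Q := Λ ^ 2 * τ * σ ^ 2 / (Lm * T) with hQ
  have hQ0 : 0 < Q := by positivity
  have hl2 : 1 ≤ l ^ 2 := one_le_pow₀ hlog
  -- `S²` carries `1 / Lm²`; one factor is traded for `1 / μ`.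
  have hSQ : S ^ 2 * τ / T ≤ Q / μ := by
    have : S ^ 2 * τ / T = Q / Lm := by rw [hS, hQ]; field_simp
    rw [this]; gcongr
  have t1 : (1 - γ * μ) ^ (T - s) * (D + κ * S) ^ 2 ≤ 12 / μ ^ 2 * l ^ 2 * Q := by
    -- The `s` steps spent on mixing cost a factor `exp (κ μ) ≤ e ≤ 3`; the rest is `hexp`, by which
    -- the step size brings the initial error down to noise level.
    have h1 : (1 - γ * μ) ^ (T - s) ≤ 3 * (τ * σ ^ 2 * Λ / (T * (D ^ 2 * μ ^ 2))) := by
      refine (one_sub_pow_le_exp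
        ((mul_le_mul_of_nonneg_right hγκ hμ.le).trans q4) (T - s)).trans ?_
      have : -(γ * μ * ((T - s : ℕ) : ℝ)) = κ * μ + -(γ * μ * T) := by
        rw [Nat.cast_sub hsT', hκ]; ring
      rw [this, Real.exp_add, hexp]
      refine mul_le_mul_of_nonneg_right ?_ (by positivity)
      exact (Real.exp_le_exp.2 q4).trans (by linarith [Real.exp_one_lt_d9])
    have h2 : (D + κ * S) ^ 2 ≤ (2 * D) ^ 2 := by gcongr; linarith
    calc _ ≤ 3 * (τ * σ ^ 2 * Λ / (T * (D ^ 2 * μ ^ 2))) * (2 * D) ^ 2 :=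
          mul_le_mul h1 h2 (sq_nonneg _) (by positivity)
      _ = 12 / μ ^ 2 * (Q * (Lm / Λ)) := by rw [hQ]; field_simp; ring
      _ ≤ 12 / μ ^ 2 * (Q * 1) := by
          gcongr
          exact (div_le_one hΛ).2 hLmΛ
      _ ≤ 12 / μ ^ 2 * (l ^ 2 * Q) := by
          rw [mul_one]
          exact mul_le_mul_of_nonneg_left (le_mul_of_one_le_left hQ0.le hl2) (by positivity)
      _ = _ := by ring
  have t2 : (66 + 8 * μ) * κ * S ^ 2 / μ ≤ 6 * (66 + 8 * μ) / μ ^ 3 * l ^ 2 * Q := by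
    calc (66 + 8 * μ) * κ * S ^ 2 / μ
        ≤ (66 + 8 * μ) * (6 * τ * l ^ 2 / (μ * T)) * S ^ 2 / μ := by gcongr
      _ = 6 * (66 + 8 * μ) / μ ^ 2 * l ^ 2 * (S ^ 2 * τ / T) := by field_simp
      _ ≤ 6 * (66 + 8 * μ) / μ ^ 2 * l ^ 2 * (Q / μ) := by gcongr
      _ = _ := by field_simp
  have t3 : 4 * (δ + e) ^ 2 * S ^ 2 / μ / μ ≤
      32 / μ ^ 3 * l ^ 2 * Q + 8 * S ^ 2 / μ ^ 2 * e ^ 2 := by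
    have h1 : (δ + e) ^ 2 ≤ 2 * δ ^ 2 + 2 * e ^ 2 := by
      nlinarith only [sq_nonneg (δ - e)]
    have h2 : δ ^ 2 ≤ 4 * (τ / T) := by
      calc δ ^ 2 ≤ (2 / (T : ℝ)) ^ 2 := by gcongr
        _ = 4 * (1 / (T : ℝ) * (1 / T)) := by ring
        _ ≤ 4 * (1 / (T : ℝ) * τ) := by
            refine mul_le_mul_of_nonneg_left (mul_le_mul_of_nonneg_left ?_ (by positivity))
              (by norm_num)
            exact ((div_le_one hT0).2 hT1').trans hτ1
        _ = _ := by ring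
    calc 4 * (δ + e) ^ 2 * S ^ 2 / μ / μ
        ≤ 4 * (2 * (4 * (τ / T)) + 2 * e ^ 2) * S ^ 2 / μ / μ := by
          gcongr
          linarith
      _ = 32 / μ ^ 2 * (S ^ 2 * τ / T) + 8 * S ^ 2 / μ ^ 2 * e ^ 2 := by field_simp; ring
      _ ≤ 32 / μ ^ 2 * (l ^ 2 * (Q / μ)) + 8 * S ^ 2 / μ ^ 2 * e ^ 2 := by
          have h3 : Q / μ ≤ l ^ 2 * (Q / μ) := le_mul_of_one_le_left (by positivity) hl2
          exact add_le_add (mul_le_mul_of_nonneg_left (hSQ.trans h3) (by positivity)) le_rfl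
      _ = _ := by field_simp
  rw [add_div]
  linarith

end Bounds

end MHLJ

/-! ### The convergence theorem -/

set_option maxHeartbeats 1600000 in
open MHLJ in
theorem theorem1 :
    ∃ k : ℕ, ∀ μ : ℝ, 0 < μ → ∃ C₁ : ℝ, 0 < C₁ ∧
    ∀ (V : Type*) [Fintype V] [DecidableEq V] [Nontrivial V]
      (G : SimpleGraph V) [DecidableRel G.Adj] (L : V → ℝ) (σ : ℝ),
      G.Connected → (∀ v, 0 < L v) → 0 < σ →
    ∃ C₂ : ℝ, 0 < C₂ ∧
    ∀ (pd : ℝ) (r : ℕ) (PL : Matrix V V ℝ), 0 < pd → pd ≤ 1 → 1 ≤ r →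
      (PL = MHLJ.levyClosed G pd r ∨ PL = MHLJ.levyWalk G pd r) →
    ∀ D : ℝ, 0 < D →
    ∃ T₀ : ℕ, ∀ T : ℕ, T₀ ≤ T →
    ∀ (pJ : ℝ) (ν : V → ℝ), 0 ≤ pJ → pJ ≤ 1 →
      MHLJ.IsStationary (MHLJ.perturbed pJ (MHLJ.PIS G L) PL) ν →
    ∀ (d : ℕ) (f : V → EuclideanSpace ℝ (Fin d) → ℝ) (xs x₀ : EuclideanSpace ℝ (Fin d)),
      (∀ v, MHLJ.IsSmooth (L v) (f v)) →
      (∀ v, StrongConvexOn Set.univ μ (f v)) →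
      (∀ y, (∑ v, f v xs) / Fintype.card V ≤ (∑ v, f v y) / Fintype.card V) →
      (∀ v, ‖gradient (f v) xs‖ ^ 2 ≤ σ ^ 2) →
      ‖x₀ - xs‖ = D →
    ∀ (Ω : Type*) [MeasurableSpace Ω] (ℙ : MeasureTheory.Measure Ω)
      [MeasureTheory.IsProbabilityMeasure ℙ] (X : ℕ → Ω → V),
      MHLJ.IsMarkovChain ℙ (MHLJ.perturbed pJ (MHLJ.PIS G L) PL) X →
    ∀ (τ : ℕ) (γ : ℝ),
      τ = MHLJ.mixingTime (MHLJ.perturbed pJ (MHLJ.PIS G L) PL) ν →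
      γ = MHLJ.stepSize (MHLJ.meanL L) μ σ D τ T →
      ∫ ω, ‖MHLJ.iterate γ L f x₀ (fun t => X t ω) T - xs‖ ^ 2 ∂ℙ ≤
        C₁ * Real.log T ^ k * (MHLJ.meanL L ^ 2 * τ * σ ^ 2 / (MHLJ.minL L * T)) +
          C₂ * (pJ ^ 2 * MHLJ.norm1 (MHLJ.PIS G L - PL) ^ 2) := by
  refine ⟨2, fun μ hμ =>
    ⟨12 / μ ^ 2 + 6 * (66 + 8 * μ) / μ ^ 3 + 32 / μ ^ 3, by positivity, ?_⟩⟩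
  intro V _ _ _ G _ L σ hG hL hσ
  obtain ⟨m₀, hm₀⟩ := exists_PIS_mixing G hG hL
  have hLb := meanL_pos hL
  have hLm := minL_pos hL
  have hLmb := minL_le_meanL L
  have hn : (0 : ℝ) < Fintype.card V := by exact_mod_cast Fintype.card_pos
  set Lb := meanL L with hLbd
  set Lm := minL L with hLmd
  set S := Lb / Lm * σ with hS
  set α := μ / (Fintype.card V : ℝ) with hα
  -- Threshold below which the bias `e = 2 m₀ ε` satisfies `e L̄ ≤ μ / 32`; the `+ 1` keeps the
  -- denominator positive when `m₀ = 0`.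
  set ε₀ : ℝ := μ / (32 * (2 * m₀ * Lb + 1)) with hε₀
  have hS0 : 0 < S := by positivity
  have hα0 : 0 < α := by positivity
  have hε₀0 : 0 < ε₀ := by positivity
  -- The two summands of `C₂` serve the regimes `ε ≥ ε₀` and `ε < ε₀`.
  refine ⟨(1 + 2 * S / α) ^ 2 / ε₀ ^ 2 + 8 * S ^ 2 / μ ^ 2 * (2 * m₀) ^ 2, by positivity, ?_⟩
  intro pd r PL hpd0 hpd1 hr hPL D hD
  obtain ⟨N, hN⟩ := exists_perturbed_mixing G hG hL hpd0 hpd1 hr hPL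
  set M := 10 + 10 * Lb + 160 * Lb ^ 2 / μ + S / D + μ + Lb ^ 2 / α + α with hM
  have hM0 : 0 < M := by positivity
  -- `N + 1` replaces `τ`, which varies with `p_J`; the successor keeps it positive. The lower bound
  -- `1 + 2 D μ / α` makes the step size positive and gives `2 D ≤ γ α T`, as the contraction bound
  -- needs.
  have hev : ∀ᶠ T : ℕ in Filter.atTop, 1 ≤ Real.log (T * 1) ∧
      1 + 2 * D * μ / α ≤ Real.log (T * (D ^ 2 * μ ^ 2 / ((N + 1 : ℕ) * σ ^ 2 * Lb))) ∧
      D ^ 2 * μ ^ 2 / (σ ^ 2 * Lb) ≤ T ∧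
      6 * (N + 1 : ℕ) / μ * M * Real.log T ^ 2 ≤ T ∧ 3 * (N + 1 : ℕ) * Real.log T ^ 1 ≤ T ∧
      64 * Lb / μ ≤ T :=
    (eventually_log_ge _ one_pos).and <| (eventually_log_ge _ (by positivity)).and <|
      (tendsto_natCast_atTop_atTop.eventually_ge_atTop _).and <|
      (eventually_mul_log_pow_le _ 2).and <| (eventually_mul_log_pow_le _ 1).and <|
      tendsto_natCast_atTop_atTop.eventually_ge_atTop _
  obtain ⟨T₀, hT₀⟩ := Filter.eventually_atTop.1 hev
  refine ⟨T₀, fun T hT => ?_⟩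
  obtain ⟨e1, e2, e3, e4, e5, e6⟩ := hT₀ T hT
  intro pJ ν hp0 hp1 hν d f xs x₀ hs hc hmin hb hx₀ Ω _ ℙ _ X hX τ γ hτd hγd
  rw [mul_one] at e1
  rw [pow_one] at e5
  have hT1 : 1 ≤ T := by
    rcases Nat.eq_zero_or_pos T with h | h
    · rw [h] at e1; simp at e1; linarith
    · exact h
  have hT0 : (0 : ℝ) < T := by exact_mod_cast hT1
  have hNν := hN pJ hp0 hp1 ν hν
  have hτ1 : 1 ≤ τ := hτd ▸ one_le_mixingTime hν.sum_eq_one hNν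
  have hτN : τ ≤ N + 1 := hτd ▸ (mixingTime_le hNν).trans (Nat.le_succ N)
  have hτN' : (τ : ℝ) ≤ (N + 1 : ℕ) := by exact_mod_cast hτN
  have hlog0 : 0 ≤ Real.log T := by linarith
  have hsmall : 6 * τ * Real.log T ^ 2 / (μ * T) * M ≤ 1 := by
    calc 6 * τ * Real.log T ^ 2 / (μ * T) * M
        = (6 * τ / μ * M * Real.log T ^ 2) / T := by field_simp
      _ ≤ (6 * (N + 1 : ℕ) / μ * M * Real.log T ^ 2) / T := by gcongr
      _ ≤ 1 := (div_le_one hT0).2 e4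
  have hrate : 2 * Real.log T / (T * μ) * M ≤ 1 := by
    refine le_trans ?_ hsmall
    have h1 : (1 : ℝ) ≤ τ := by exact_mod_cast hτ1
    have h2 : Real.log T ≤ τ * Real.log T ^ 2 :=
      (le_self_pow₀ e1 two_ne_zero).trans (le_mul_of_one_le_left (by positivity) h1)
    rw [mul_comm (T : ℝ) μ]
    refine mul_le_mul_of_nonneg_right (div_le_div_of_nonneg_right ?_ (by positivity)) hM0.le
    linarith only [h2, hlog0]
  have hM1 : 0 ≤ 10 * Lb := by positivity
  have hM2 : 0 ≤ 160 * Lb ^ 2 / μ := by positivity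
  have hM3 : 0 ≤ S / D := by positivity
  have hM4 : 0 ≤ Lb ^ 2 / α := by positivity
  have hstep : 2 * Real.log T / (T * μ) ≤ 1 / Lb := by
    rw [le_div_iff₀ hLb]
    refine le_trans (mul_le_mul_of_nonneg_left ?_ (by positivity)) hrate
    linarith
  obtain ⟨g1, g2, g3, g4⟩ := stepSize_spec hLb hμ hσ hD hτ1 hτN hT1
    (by have : 0 < 2 * D * μ / α := by positivity
        linarith) e3 hstep
  rw [← hγd] at g1 g2 g3 g4
  have hfield : IsMonotoneField α Lb S xs (fun v x => (meanL L / L v) • gradient (f v) x) :=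
    isMonotoneField_gradient hL hμ hσ hs hc hb
  simp only [iterate_eq_orbit]
  set ε : ℝ := pJ * norm1 (PIS G L - PL) with hε
  have hε0 : 0 ≤ ε := mul_nonneg hp0 (norm1_nonneg _)
  have hQ : 0 ≤ (12 / μ ^ 2 + 6 * (66 + 8 * μ) / μ ^ 3 + 32 / μ ^ 3) * Real.log T ^ 2 *
      (Lb ^ 2 * τ * σ ^ 2 / (Lm * T)) := by positivity
  rw [← mul_pow, ← hε]
  by_cases hcase : ε < ε₀
  · have hne : x₀ ≠ xs := by
      rintro rfl
      simp at hx₀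
      linarith
    obtain ⟨v₀, hv₀⟩ := exists_minL_eq L
    have hμLm : μ ≤ Lm := by
      rw [hLmd, ← hv₀]
      exact (hs v₀).le_of_strongConvexOn (hc v₀) hne
    have hpert := sum_abs_stationary_sub_le (PIS_mem_rowStochastic G hL) (isStationary_PIS G hL)
      hν hm₀ (fun i => sum_abs_perturbed_sub_le (PIS G L) PL hp0 i)
    have hPs := perturbed_mem_rowStochastic (PIS_mem_rowStochastic G hL)
      (levy_spec G hpd0 hpd1 hr hPL).1 hp0 hp1
    have hmixν := fun m v => hν.sum_abs_pow_mul_sub_le hPs (mixingTime_spec hNν) m v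
    rw [← hτd] at hmixν
    have he : 2 * m₀ * ε * Lb ≤ μ / 32 := by
      have h1 : 2 * m₀ * ε * Lb ≤ (2 * m₀ * Lb + 1) * ε₀ := by
        have h3 : 2 * m₀ * Lb * ε ≤ 2 * m₀ * Lb * ε₀ := by gcongr
        linarith
      have h2 : (2 * m₀ * Lb + 1) * ε₀ = μ / 32 := by rw [hε₀]; field_simp
      linarith
    have main := hfield.integral_norm_sq_orbit_le_log hX hα0 hμ hσ hLm hLmb hμLm hD hx₀
      (e := 2 * m₀ * ε) he
      (fun m v => by
        calc _ ≤ ∑ b, (|(perturbed pJ (PIS G L) PL ^ (m * τ)) v b - ν b| +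
              |ν b - L b / ∑ u, L u|) := Finset.sum_le_sum fun b _ => abs_sub_le _ _ _
          _ ≤ _ := by
              rw [Finset.sum_add_distrib]
              exact add_le_add (hmixν m v) hpert)
      (sum_inner_gradient_ge hL hs hc hmin) hτ1 e1 g1 g2 g3 hsmall
      (by
        refine le_trans ?_ e5
        gcongr)
      (by rw [div_le_iff₀ hμ] at e6; linarith)
    refine main.trans (add_le_add le_rfl ?_)
    rw [mul_pow _ ε, ← mul_assoc, add_mul]
    have : 0 ≤ (1 + 2 * S / α) ^ 2 / ε₀ ^ 2 * ε ^ 2 := by positivity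
    linarith
  -- Large perturbation: `ε² / ε₀² ≥ 1`, so a constant bound on the error suffices.
  · have hγM : γ * M ≤ 1 := (mul_le_mul_of_nonneg_right g2 hM0.le).trans hrate
    have crude := hfield.integral_norm_sq_orbit_le_of_contraction (x₀ := x₀) hX hα0 g1.le
      (by
        have h1 : γ * (Lb ^ 2 / α) ≤ γ * M := by gcongr; linarith
        have h2 := h1.trans hγM
        rwa [← mul_div_assoc, div_le_one hα0] at h2)
      (le_trans (by gcongr; linarith) hγM)
      (T := T)
      (by
        rw [hx₀]
        have h1 : 2 * D * μ / α ≤ γ * μ * T := by linarith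
        rw [div_le_iff₀ hα0] at h1
        refine le_of_mul_le_mul_right ?_ hμ
        linarith)
    refine crude.trans ?_
    have h1 : (1 + 2 * S / α) ^ 2 ≤ (1 + 2 * S / α) ^ 2 / ε₀ ^ 2 * ε ^ 2 := by
      rw [div_mul_eq_mul_div, le_div_iff₀ (by positivity)]
      have := not_lt.1 hcase
      gcongr
    have h2 : 0 ≤ 8 * S ^ 2 / μ ^ 2 * (2 * m₀) ^ 2 * ε ^ 2 := by positivity
    rw [add_mul]
    linarith
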